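/- Fix a countably infinite domain $\mathbf{Dom}$ of constants, named by binary words, and a finite relational schema $\Sigma$. An *instance* is a finite set of facts $R(c_1,\dots,c_n)$ with $R\in\Sigma$ of arity $n$ and $c_i\in\mathbf{Dom}$. A *query* $Q$ is a finite expression over a finite set of syntax symbols and the constants; it has an arity and assigns to each instance $\mathbf I$ a set $Q(\mathbf I)$ of tuples of constants of that arity; $\mathrm{adom}(Q)$ is the set of constants occurring in the expression $Q$. The query $Q$ is *generic* if $\rho(Q(\mathbf I))=Q(\rho(\mathbf I))$ for every instance $\mathbf I$ and every bijection $\rho:\mathbf{Dom}\to\mathbf{Dom}$ that fixes $\mathrm{adom}(Q)$ pointwise. An *update* of $\mathbf I$ is a pair $U=(\mathrm{Ins},\mathrm{Del})$ of finite sets of facts with $\mathrm{Ins}\cap\mathbf I=\emptyset$ and $\mathrm{Del}\subseteq\mathbf I$; its size is $|\mathrm{Ins}\cup\mathrm{Del}|$, and $\mathbf I_U=(\mathbf I\cup\mathrm{Ins})\setminus\mathrm{Del}$. It is a *repair* with respect to $\langle Q,\mathbf I,\bar a\rangle$ if $\bar a\in Q(\mathbf I_U)$. For a class $\mathcal L$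 of queries, let $\mathrm{Eval}^{\mathcal L}$ be the problem: given $\langle Q,\mathbf I,\bar a\rangle$ with $Q\in\mathcal L$ and $\bar a$ a tuple of constants whose length is the arity of $Q$, is $\bar a\in Q(\mathbf I)$? Let $\mathrm{MA}_{bound}^{\mathcal L}$ be the problem: given $\langle Q,\mathbf I,\bar a,k\rangle$ with $Q,\mathbf I,\bar a$ as before and $k\in\mathbb N$ in binary, is there a repair of size at most $k$ with respect to $\langle Q,\mathbf I,\bar a\rangle$? (The schema is fixed; the query is part of the input, and an instance is given by a list of its facts.) **Proposition.** Let $\mathcal L$ be a class of generic queries. If $\mathrm{Eval}^{\mathcal L}\in\mathrm{NEXP}=\bigcup_{p}\mathrm{NTIME}(2^{p(n)})$, then $\mathrm{MA}_{bound}^{\mathcal L}\in\mathrm{2NEXP}=\bigcup_{p}\mathrm{NTIME}(2^{2^{p(n)}})$, where $p$ ranges over the polynomials. -/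

import Mathlib

/-! ### Nondeterministic Turing machines and time classes -/

/-- A nondeterministic multi-stack Turing machine with input alphabet `A`: Mathlib's `TM2` machine
model with finitely many stacks (a work tape is a pair of stacks), finite stack alphabets, finitely
many labels and finitely many internal states, and with two transition functions `prog false` and
`prog true`. At every step the machine chooses freely which of the two it applies. -/
structure NTM (A : Type) where
  /-- index type of the stacks -/
  K : Type
  [decK : DecidableEq K]
  [finK : Fintype K]
  /-- stack alphabets -/
  Γ : K → Type
  [finΓ : ∀ k, Fintype (Γ k)]
  /-- labels -/
  Λ : Type
  [finΛ : Fintype Λ]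
  /-- internal states -/
  σ : Type
  [finσ : Fintype σ]
  /-- the stack that holds the input in the beginning; all other stacks are empty then -/
  inStack : K
  /-- how an input letter is written on the input stack -/
  inLetter : A ↪ Γ inStack
  /-- the initial label -/
  start : Λ
  /-- the initial internal state -/
  init : σ
  /-- the internal states in which halting means acceptance -/
  accept : Set σ
  /-- the two transition functions -/
  prog : Bool → Λ → Turing.TM2.Stmt Γ Λ σ

namespace NTM

variable {A : Type} (M : NTM A)

/-- Configurations: current label (`none` once halted), internal state, contents of the stacks. -/
abbrev Cfg : Type := Turing.TM2.Cfg M.Γ M.Λ M.σ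

/-- The initial configuration on the input word `w` (its first letter is on top of the stack). -/
def initial (w : List A) : M.Cfg where
  l := some M.start
  var := M.init
  stk := @Function.update M.K (fun k => List (M.Γ k)) M.decK (fun _ => []) M.inStack
    (w.map M.inLetter)

/-- `c'` is one of the (at most two) successor configurations of `c`. -/
def Step (c c' : M.Cfg) : Prop :=
  ∃ b : Bool, @Turing.TM2.step M.K M.Γ M.Λ M.σ M.decK (M.prog b) c = some c'

/-- `M.StepsTo t c c'`: some computation of exactly `t` steps leads from `c` to `c'`. -/
inductive StepsTo : ℕ → M.Cfg → M.Cfg → Prop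
  | refl (c : M.Cfg) : StepsTo 0 c c
  | head {t : ℕ} {c c' c'' : M.Cfg} : M.Step c c' → StepsTo t c' c'' → StepsTo (t + 1) c c''

/-- A halted configuration in an accepting internal state. -/
def Accepting (c : M.Cfg) : Prop := c.l = none ∧ c.var ∈ M.accept

/-- `M` has an accepting computation of exactly `t` steps on the input `w`. -/
def AcceptsIn (w : List A) (t : ℕ) : Prop :=
  ∃ c : M.Cfg, M.StepsTo t (M.initial w) c ∧ M.Accepting c

end NTM

/-- `NTIME T`: the languages `P` of the nondeterministic machines `M` that work in time `T`, that
is, `M` accepts (by some computation) exactly the words of `P`, and every `w ∈ P` has an accepting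
computation of at most `T |w|` steps. For time-constructible bounds, as those used below, it makes
no difference if one asks moreover that all computations stop in time, since a clock can be added
to `M`. -/
def NTIME {A : Type} (T : ℕ → ℕ) : Set (Language A) :=
  {P | ∃ M : NTM A,
    (∀ w t, M.AcceptsIn w t → w ∈ P) ∧ (∀ w ∈ P, ∃ t ≤ T w.length, M.AcceptsIn w t)}

/-- Nondeterministic time `2 ^ poly(n)`. -/
def NEXP {A : Type} : Set (Language A) :=
  {P | ∃ p : Polynomial ℕ, P ∈ NTIME fun n => 2 ^ p.eval n}

/-- Nondeterministic time `2 ^ 2 ^ poly(n)`. -/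
def TwoNEXP {A : Type} : Set (Language A) :=
  {P | ∃ p : Polynomial ℕ, P ∈ NTIME fun n => 2 ^ 2 ^ p.eval n}

/-! ### Databases, queries and updates -/

namespace MissingAnswer

/-- The countably infinite domain of constants: all binary words (the names of the constants). -/
abbrev Dom : Type := List Bool

/-- A finite relational schema. -/
structure Schema where
  Rel : Type
  [finRel : Fintype Rel]
  [decRel : DecidableEq Rel]
  arity : Rel → ℕ

attribute [instance] Schema.finRel Schema.decRel

/-- A fact `R(c₁, …, cₙ)` with `n` the arity of `R`. -/
abbrev Fact (S : Schema) : Type := Σ r : S.Rel, Fin (S.arity r) → Dom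

/-- An instance is a finite set of facts. -/
abbrev Instance (S : Schema) : Type := Finset (Fact S)

/-- Replace each constant of a fact by its image under `ρ`. -/
def Fact.rename {S : Schema} (ρ : Dom → Dom) (f : Fact S) : Fact S := ⟨f.1, ρ ∘ f.2⟩

/-- `ρ(I)`: replace each constant in each fact of `I` by its image under `ρ`. -/
def Instance.rename {S : Schema} (ρ : Dom → Dom) (I : Instance S) : Instance S :=
  Finset.image (Fact.rename ρ) I

/-- An arbitrary class of queries over the schema `S`. Queries are finite expressions, i.e. words
over a finite set of syntax symbols together with the constants. (Variables, for instance, are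
spelled with syntax symbols.) Each query has an arity and maps every instance to a set of tuples of
that arity. The values of `arity` and `ans` outside `queries` are irrelevant. -/
structure QueryClass (S : Schema) where
  /-- the syntax symbols -/
  Symb : Type
  [finSymb : Fintype Symb]
  /-- the queries that belong to the class -/
  queries : Set (List (Symb ⊕ Dom))
  arity : List (Symb ⊕ Dom) → ℕ
  /-- `ans Q I` is the answer `Q(I)` -/
  ans : (Q : List (Symb ⊕ Dom)) → Instance S → Set (Fin (arity Q) → Dom)

/-- The set `adom(Q)` of constants that occur in the query `Q`. -/
def adom {Symb : Type} (Q : List (Symb ⊕ Dom)) : Set Dom := {d | Sum.inr d ∈ Q}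

/-- An update of `I`: finite sets of facts to be inserted and deleted. -/
structure Update {S : Schema} (I : Instance S) where
  ins : Finset (Fact S)
  del : Finset (Fact S)
  ins_new : Disjoint ins I
  del_old : del ⊆ I

namespace Update

variable {S : Schema} {I : Instance S}

/-- The updated instance `I_U = (I ∪ Ins) \ Del`. -/
def apply (U : Update I) : Instance S := (I ∪ U.ins) \ U.del

/-- The size of an update: the number of its insertions and deletions. -/
def size (U : Update I) : ℕ := (U.ins ∪ U.del).card

end Update

/-! ### Encoding of the inputs -/

/-- The finite alphabet in which inputs are written. -/
inductive Letter (Symb Rel : Type) : Type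
  | sym (s : Symb)
  | rel (r : Rel)
  /-- marks the beginning of a constant -/
  | const
  | bit (b : Bool)
  /-- separates the components of an input -/
  | sep

section Encoding

variable {Symb : Type} {S : Schema}

/-- A binary word. -/
def encBits (d : List Bool) : List (Letter Symb S.Rel) := d.map Letter.bit

/-- A constant: a mark followed by its name. -/
def encConst (d : Dom) : List (Letter Symb S.Rel) := Letter.const :: encBits d

/-- A tuple of constants. -/
def encTuple {n : ℕ} (a : Fin n → Dom) : List (Letter Symb S.Rel) :=
  (List.ofFn a).flatMap encConst

/-- A query expression, token by token. -/
def encQuery (Q : List (Symb ⊕ Dom)) : List (Letter Symb S.Rel) :=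
  Q.flatMap (Sum.elim (fun s => [Letter.sym s]) encConst)

/-- A list of facts; a fact is its relation symbol followed by its tuple of constants. -/
def encFacts (F : List (Fact S)) : List (Letter Symb S.Rel) :=
  F.flatMap fun f => Letter.rel f.1 :: encTuple f.2

/-- The word for `⟨Q, I, a⟩`, where `I` is given by a list `F` of its facts. -/
def encEvalInput (Q : List (Symb ⊕ Dom)) (F : List (Fact S)) {n : ℕ} (a : Fin n → Dom) :
    List (Letter Symb S.Rel) :=
  encQuery Q ++ Letter.sep :: (encFacts F ++ Letter.sep :: encTuple a)

/-- The word for `⟨Q, I, a, k⟩`, with `k` in binary (least significant bit first). -/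
def encMAInput (Q : List (Symb ⊕ Dom)) (F : List (Fact S)) {n : ℕ} (a : Fin n → Dom) (k : ℕ) :
    List (Letter Symb S.Rel) :=
  encEvalInput Q F a ++ Letter.sep :: encBits k.bits

end Encoding

/-! ### The decision problems of a class of queries -/

namespace QueryClass

variable {S : Schema} (L : QueryClass S)

/-- `Q` is `D`-generic: `ρ(Q(I)) = Q(ρ(I))` for every instance `I` and every bijection `ρ` of the
domain that fixes `D` pointwise. -/
def IsGenericOver (Q : List (L.Symb ⊕ Dom)) (D : Set Dom) : Prop :=
  ∀ (I : Instance S) (ρ : Equiv.Perm Dom), (∀ d ∈ D, ρ d = d) →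
    (fun t : Fin (L.arity Q) → Dom => ρ ∘ t) '' L.ans Q I = L.ans Q (Instance.rename ρ I)

/-- All queries `Q` of the class are generic, i.e. `adom(Q)`-generic. -/
def IsGeneric : Prop := ∀ Q ∈ L.queries, L.IsGenericOver Q (adom Q)

/-- The evaluation problem: given `⟨Q, I, a⟩` with `Q` in the class, is `a ∈ Q(I)`? -/
def Eval : Language (Letter L.Symb S.Rel) :=
  {w | ∃ Q ∈ L.queries, ∃ (F : List (Fact S)) (a : Fin (L.arity Q) → Dom),
    w = encEvalInput Q F a ∧ a ∈ L.ans Q F.toFinset}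

/-- `U` is a repair with respect to `⟨Q, I, a⟩` if `a ∈ Q(I_U)`. -/
def IsRepair (Q : List (L.Symb ⊕ Dom)) {I : Instance S} (a : Fin (L.arity Q) → Dom)
    (U : Update I) : Prop := a ∈ L.ans Q U.apply

/-- The bounded missing answer problem: given `⟨Q, I, a, k⟩` with `Q` in the class, is there a
repair of size at most `k` with respect to `⟨Q, I, a⟩`? -/
def MABound : Language (Letter L.Symb S.Rel) :=
  {w | ∃ Q ∈ L.queries, ∃ (F : List (Fact S)) (a : Fin (L.arity Q) → Dom) (k : ℕ),
    w = encMAInput Q F a k ∧ ∃ U : Update F.toFinset, L.IsRepair Q a U ∧ U.size ≤ k}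

end QueryClass

end MissingAnswer

/-!
Suppose an update `J` of `I` of size at most `k` is a repair. Genericity lets one rename the
constants of `I ∆ J` by a permutation fixing the constants of `I`, `Q` and `a`. Since `k` is written
in binary, `I ∆ J` has at most exponentially many constants, so words of polynomial length suffice
as new names. Hence there is an exponentially long description of a repair as soon as there is a
repair, and a nondeterministic machine can guess it, write the updated instance in place of `I`, and
run the machine for `Eval` on the result. That machine needs time `2 ^ p(m)` on an input of length
`m`, and here `m` is exponential in the length of the original input.

Turing machines are unwieldy to compose, so the guessing phase is a regular expression over stack
operations, read as a relation on stack contents; every iteration in it is bounded by a number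
`n` that is exponential in the input, which bounds the running time by a polynomial in `n`.
-/

/-- Nondeterministic programs on stacks that are indexed by `K` and hold letters from `A`. `pop k a`
gets stuck unless `a` is on top of stack `k`, and `empty k` gets stuck unless stack `k` is empty;
`star p` runs `p` an arbitrary number of times. -/
inductive StackProg (K A : Type) : Type
  | push (k : K) (a : A)
  | pop (k : K) (a : A)
  | empty (k : K)
  | fail
  | seq (p q : StackProg K A)
  | alt (p q : StackProg K A)
  | star (p : StackProg K A)

/-- The instructions of flow charts with labels from `Λ`, into which stack programs are compiled. -/
inductive FlowInstr (K A Λ : Type) : Type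
  | push (k : K) (a : A) (l : Λ)
  | pop (k : K) (a : A) (l : Λ)
  | empty (k : K) (l : Λ)
  | fail
  | fork (l l' : Λ)

namespace StackProg

variable {K A : Type}

/-- `p.Run n s s'`: some run of `p` leads from the stacks `s` to the stacks `s'`, where every loop,
each time it is reached, is iterated at most `n` times. -/
def Run [DecidableEq K] (n : ℕ) : StackProg K A → (K → List A) → (K → List A) → Prop
  | push k a, s, s' => s' = Function.update s k (a :: s k)
  | pop k a, s, s' => ∃ l, s k = a :: l ∧ s' = Function.update s k l
  | empty k, s, s' => s k = [] ∧ s' = s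
  | fail, _, _ => False
  | seq p q, s, s' => ∃ s₁, p.Run n s s₁ ∧ q.Run n s₁ s'
  | alt p q, s, s' => p.Run n s s' ∨ q.Run n s s'
  | star p, s, s' => ∃ m ≤ n, (Relation.Comp (p.Run n))^[m] Eq s s'

/-- A bound for the number of steps in the runs of a program whose loops are iterated at most `X`
times. -/
noncomputable def timeBound : StackProg K A → Polynomial ℕ
  | seq p q => p.timeBound + q.timeBound
  | alt p q => p.timeBound + q.timeBound + 1
  | star p => Polynomial.X * (p.timeBound + 1) + 1
  | push _ _ | pop _ _ | empty _ | fail => 1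

/-- The labels of the flow chart of a program. -/
def Lbl : StackProg K A → Type
  | seq p q => p.Lbl ⊕ q.Lbl
  | alt p q => Option (p.Lbl ⊕ q.Lbl)
  | star p => Option p.Lbl
  | push _ _ | pop _ _ | empty _ | fail => Unit

instance Lbl.finite : (p : StackProg K A) → Finite p.Lbl
  | seq p q =>
    have := Lbl.finite p
    have := Lbl.finite q
    inferInstanceAs (Finite (p.Lbl ⊕ q.Lbl))
  | alt p q =>
    have := Lbl.finite p
    have := Lbl.finite q
    inferInstanceAs (Finite (Option (p.Lbl ⊕ q.Lbl)))
  | star p =>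
    have := Lbl.finite p
    inferInstanceAs (Finite (Option p.Lbl))
  | push _ _ | pop _ _ | empty _ | fail => inferInstanceAs (Finite Unit)

/-- The label at which the flow chart of a program is entered. -/
def entry : (p : StackProg K A) → p.Lbl
  | seq p _ => (Sum.inl p.entry : _ ⊕ _)
  | alt _ _ | star _ => (none : Option _)
  | push _ _ | pop _ _ | empty _ | fail => ()

/-- The flow chart of a program, where `e` embeds the labels into a type `Λ` and `x` is the label
that is reached at the end. -/
def code {Λ : Type} : (p : StackProg K A) → (e : p.Lbl → Λ) → (x : Λ) → p.Lbl → FlowInstr K A Λ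
  | seq p q, e, x, l =>
    match (l : p.Lbl ⊕ q.Lbl) with
    | .inl l => p.code (fun l => e (Sum.inl l : _ ⊕ _)) (e (Sum.inr q.entry : _ ⊕ _)) l
    | .inr l => q.code (fun l => e (Sum.inr l : _ ⊕ _)) x l
  | alt p q, e, x, l =>
    match (l : Option (p.Lbl ⊕ q.Lbl)) with
    | none => .fork (e (some (.inl p.entry) : Option _)) (e (some (.inr q.entry) : Option _))
    | some (.inl l) => p.code (fun l => e (some (.inl l) : Option _)) x l
    | some (.inr l) => q.code (fun l => e (some (.inr l) : Option _)) x l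
  | star p, e, x, l =>
    match (l : Option p.Lbl) with
    | none => .fork x (e (some p.entry : Option _))
    | some l => p.code (fun l => e (some l : Option _)) (e (none : Option _)) l
  | push k a, _, x, _ => .push k a x
  | pop k a, _, x, _ => .pop k a x
  | empty k, _, x, _ => .empty k x
  | fail, _, _, _ => .fail

theorem iterate_relComp_mono {α : Type*} {r r' : α → α → Prop} (h : ∀ x y, r x y → r' x y)
    {i : ℕ} {x y : α} (hi : (Relation.Comp r)^[i] Eq x y) : (Relation.Comp r')^[i] Eq x y := by
  induction i generalizing x with
  | zero => exact hi
  | succ i ih =>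
    rw [Function.iterate_succ_apply'] at hi ⊢
    obtain ⟨z, hz, hi⟩ := hi
    exact ⟨z, h _ _ hz, ih hi⟩

theorem Run.mono [DecidableEq K] {p : StackProg K A} {m n : ℕ} (hmn : m ≤ n) {s s' : K → List A}
    (h : p.Run m s s') : p.Run n s s' := by
  induction p generalizing s s' with
  | push | pop | empty | fail => exact h
  | seq p q ihp ihq =>
    obtain ⟨s₁, hp, hq⟩ := h
    exact ⟨s₁, ihp hp, ihq hq⟩
  | alt p q ihp ihq => exact h.imp ihp ihq
  | star p ih =>
    obtain ⟨i, hi, h⟩ := h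
    exact ⟨i, hi.trans hmn, iterate_relComp_mono (fun _ _ => ih) h⟩

theorem Run.star_cons [DecidableEq K] {p : StackProg K A} {m n : ℕ} {s s₁ s' : K → List A}
    (h : p.Run m s s₁) (h' : p.star.Run n s₁ s') : p.star.Run (max m (n + 1)) s s' := by
  obtain ⟨i, hi, h'⟩ := h'
  refine ⟨i + 1, le_max_of_le_right (Nat.succ_le_succ hi), ?_⟩
  rw [Function.iterate_succ_apply']
  exact ⟨s₁, h.mono (le_max_left ..), iterate_relComp_mono
    (fun _ _ => Run.mono (n.le_succ.trans (le_max_right ..))) h'⟩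

theorem Run.star_invariant [DecidableEq K] {p : StackProg K A} {n : ℕ}
    {I : (K → List A) → Prop} (hI : ∀ s s', I s → p.Run n s s' → I s') {s s' : K → List A}
    (h : p.star.Run n s s') (hs : I s) : I s' := by
  obtain ⟨m, -, h⟩ := h
  induction m generalizing s with
  | zero => exact h ▸ hs
  | succ m ih =>
    rw [Function.iterate_succ_apply'] at h
    obtain ⟨s₁, h₁, h⟩ := h
    exact ih (hI _ _ hs h₁) h

end StackProg

/-- `i.Step s l s'`: the instruction `i` turns the stacks `s` into `s'` and continues at the
label `l`. -/
def FlowInstr.Step {K A Λ : Type} [DecidableEq K] :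
    FlowInstr K A Λ → (K → List A) → Λ → (K → List A) → Prop
  | push k a x, s, l, s' => l = x ∧ s' = Function.update s k (a :: s k)
  | pop k a x, s, l, s' => l = x ∧ ∃ u, s k = a :: u ∧ s' = Function.update s k u
  | empty k x, s, l, s' => l = x ∧ s k = [] ∧ s' = s
  | fail, _, _, _ => False
  | fork x y, s, l, s' => (l = x ∨ l = y) ∧ s' = s

namespace NTM

variable {A : Type}

/-- `M` has an accepting computation of exactly `t` steps that starts in `c`. -/
def AccFrom (M : NTM A) (t : ℕ) (c : M.Cfg) : Prop := ∃ c', M.StepsTo t c c' ∧ M.Accepting c'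

/-- `M` has an accepting computation of at most `t` steps that starts in `c`. -/
def AccWithin (M : NTM A) (t : ℕ) (c : M.Cfg) : Prop := ∃ t' ≤ t, M.AccFrom t' c

theorem accFrom_zero {M : NTM A} {c : M.Cfg} : M.AccFrom 0 c ↔ M.Accepting c := by
  constructor
  · rintro ⟨c', h, h'⟩
    cases h
    exact h'
  · exact fun h => ⟨c, .refl c, h⟩

theorem accFrom_succ {M : NTM A} {t : ℕ} {c : M.Cfg} :
    M.AccFrom (t + 1) c ↔ ∃ c', M.Step c c' ∧ M.AccFrom t c' := by
  constructor
  · rintro ⟨c', h, h'⟩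
    cases h with
    | head h₁ h₂ => exact ⟨_, h₁, _, h₂, h'⟩
  · rintro ⟨c', h, c'', h₂, h'⟩
    exact ⟨c'', .head h h₂, h'⟩

theorem accFrom_none {M : NTM A} {t : ℕ} {v : M.σ} {S : ∀ k, List (M.Γ k)} :
    M.AccFrom t ⟨none, v, S⟩ ↔ t = 0 ∧ v ∈ M.accept := by
  cases t with
  | zero => simp [accFrom_zero, Accepting]
  | succ t => simp [accFrom_succ, Step, Turing.TM2.step]

theorem accFrom_some_succ {M : NTM A} {t : ℕ} {l : M.Λ} {v : M.σ} {S : ∀ k, List (M.Γ k)} :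
    M.AccFrom (t + 1) ⟨some l, v, S⟩ ↔
      ∃ b, M.AccFrom t (@Turing.TM2.stepAux M.K M.Γ M.Λ M.σ M.decK (M.prog b l) v S) := by
  simp only [accFrom_succ, Step, Turing.TM2.step, Option.some_inj]
  exact ⟨fun ⟨_, ⟨b, hb⟩, h⟩ => ⟨b, hb ▸ h⟩, fun ⟨b, h⟩ => ⟨_, ⟨b, rfl⟩, h⟩⟩

theorem not_accFrom_some_zero {M : NTM A} {l : M.Λ} {v : M.σ} {S : ∀ k, List (M.Γ k)} :
    ¬ M.AccFrom 0 ⟨some l, v, S⟩ := by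
  simp [accFrom_zero, Accepting]

theorem AccWithin.mono {M : NTM A} {t t' : ℕ} {c : M.Cfg} (h : M.AccWithin t c) (htt : t ≤ t') :
    M.AccWithin t' c := by
  obtain ⟨u, hu, h⟩ := h
  exact ⟨u, hu.trans htt, h⟩

theorem AccWithin.of_iterate_relComp {M : NTM A} {α : Type*} {r : α → α → Prop} {f : α → M.Cfg}
    {d : ℕ} (hr : ∀ t x y, r x y → M.AccWithin t (f y) → M.AccWithin (t + d) (f x)) {m t : ℕ}
    {x y : α} (hxy : (Relation.Comp r)^[m] Eq x y) (h : M.AccWithin t (f y)) :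
    M.AccWithin (t + m * d) (f x) := by
  induction m generalizing x with
  | zero =>
    obtain rfl : x = y := hxy
    exact h.mono (Nat.le_add_right ..)
  | succ m ih =>
    rw [Function.iterate_succ_apply'] at hxy
    obtain ⟨z, hxz, hzy⟩ := hxy
    exact (hr _ _ _ hxz (ih hzy)).mono (by lia)

/-! ### Running a machine on the output of a stack program -/

section Prepend

open Turing.TM2

variable (M : NTM A) {K : Type} (p : StackProg K A)

/-- The stack alphabets of the machine that runs a stack program and then `M`. -/
abbrev PreΓ (K : Type) : M.K ⊕ K → Type
  | .inl k => M.Γ k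
  | .inr _ => A

/-- The labels of the machine that runs `p` and then `M`; `Sum.inr none` is the loop that copies the
output of `p` to the input stack of `M`. -/
abbrev PreΛ : Type := p.Lbl ⊕ Option M.Λ

/-- The internal states of the machine that runs a stack program and then `M`. While the program is
running, a letter in the first component means that the program got stuck. -/
abbrev Preσ : Type := Option A × M.σ

/-- The statements of `M` as statements of the machine that runs `p` and then `M`. -/
def liftStmt : Stmt M.Γ M.Λ M.σ → Stmt (M.PreΓ K) (M.PreΛ p) M.Preσ
  | .push k f q => .push (Sum.inl k) (fun s => f s.2) (liftStmt q)
  | .peek k f q => .peek (Sum.inl k) (fun s o => (s.1, f s.2 o)) (liftStmt q)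
  | .pop k f q => .pop (Sum.inl k) (fun s o => (s.1, f s.2 o)) (liftStmt q)
  | .load f q => .load (fun s => (s.1, f s.2)) (liftStmt q)
  | .branch f q r => .branch (fun s => f s.2) (liftStmt q) (liftStmt r)
  | .goto f => .goto fun s => .inr (some (f s.2))
  | .halt => .halt

open Classical in
/-- The machine statement for an instruction of a flow chart; `b` selects the branch of a fork. -/
noncomputable def instrStmt [Inhabited A] (b : Bool) :
    FlowInstr K A (M.PreΛ p) → Stmt (M.PreΓ K) (M.PreΛ p) M.Preσ
  | .push k a l => .push (Sum.inr k) (fun _ => a) (.goto fun _ => l)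
  | .pop k a l => .pop (Sum.inr k) (fun s o => (if o = some a then none else some a, s.2))
      (.branch (fun s => s.1.isNone) (.goto fun _ => l) .halt)
  | .empty k l => .peek (Sum.inr k) (fun s o => (o, s.2))
      (.branch (fun s => s.1.isNone) (.goto fun _ => l) .halt)
  | .fail => .load (fun s => (some default, s.2)) .halt
  | .fork l l' => .goto fun _ => bif b then l' else l

/-- The machine statement that moves a letter from the output stack of a stack program to the input
stack of `M`, or starts `M` if there is no letter left. -/
def copyStmt [Inhabited A] (out : K) : Stmt (M.PreΓ K) (M.PreΛ p) M.Preσ :=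
  .pop (Sum.inr out) (fun s o => (o, s.2))
    (.branch (fun s => s.1.isSome)
      (.push (Sum.inl M.inStack) (fun s => M.inLetter (s.1.getD default))
        (.load (fun s => (none, s.2)) (.goto fun _ => .inr none)))
      (.goto fun _ => .inr (some M.start)))

instance : DecidableEq M.K := M.decK
instance : Fintype M.K := M.finK
instance : Fintype M.Λ := M.finΛ
instance : Fintype M.σ := M.finσ
instance (k : M.K) : Fintype (M.Γ k) := M.finΓ k

/-- The machine that runs the program `p`, with input stack `inp`, and then `M` on the content of
the stack `out`, read from bottom to top. -/
@[reducible] noncomputable def prepend [Inhabited A] [Fintype A] [DecidableEq K] [Fintype K]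
    (inp out : K) : NTM A where
  K := M.K ⊕ K
  Γ := M.PreΓ K
  finΓ := fun k => by cases k <;> infer_instance
  Λ := M.PreΛ p
  finΛ := Fintype.ofFinite _
  σ := M.Preσ
  inStack := .inr inp
  inLetter := Function.Embedding.refl A
  start := .inl p.entry
  init := (none, M.init)
  accept := {s | s.1 = none ∧ s.2 ∈ M.accept}
  prog b
    | .inl l => M.instrStmt p b (p.code .inl (.inr none) l)
    | .inr none => M.copyStmt p out
    | .inr (some l) => M.liftStmt p (M.prog b l)

variable {M p}

/-- The stacks of the machine that runs a stack program and then `M`, put together from those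
of `M` and those of the program. -/
def joinStk (T : ∀ k, List (M.Γ k)) (S : K → List A) : ∀ k, List (M.PreΓ K k)
  | .inl k => T k
  | .inr k => S k

theorem update_joinStk_inl [DecidableEq K] (T : ∀ k, List (M.Γ k)) (S : K → List A) (k : M.K)
    (l : List (M.Γ k)) :
    Function.update (joinStk T S) (.inl k) l = joinStk (Function.update T k l) S := by
  refine Function.update_eq_iff.2 ⟨(Function.update_self k l T).symm, fun j hj => ?_⟩
  rcases j with j | j
  · exact (Function.update_of_ne (fun h => hj (congrArg Sum.inl h)) l T).symm
  · rfl

theorem update_joinStk_inr [DecidableEq K] (T : ∀ k, List (M.Γ k)) (S : K → List A) (k : K)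
    (l : List A) :
    Function.update (joinStk T S) (.inr k) l = joinStk T (Function.update S k l) := by
  refine Function.update_eq_iff.2 ⟨(Function.update_self k l S).symm, fun j hj => ?_⟩
  rcases j with j | j
  · rfl
  · exact (Function.update_of_ne (fun h => hj (congrArg Sum.inr h)) l S).symm

variable [Inhabited A] [Fintype A] [DecidableEq K] [Fintype K] {inp out : K}

/-- A configuration of `M` as a configuration of the machine that runs `p` and then `M`. -/
def liftCfg (S : K → List A) (c : M.Cfg) : (M.prepend p inp out).Cfg :=
  ⟨c.l.map fun l => .inr (some l), (none, c.var), joinStk c.stk S⟩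

theorem stepAux_liftStmt (q : Stmt M.Γ M.Λ M.σ) (v : M.σ) (T : ∀ k, List (M.Γ k))
    (S : K → List A) :
    stepAux (M.liftStmt p q) (none, v) (joinStk T S) =
      liftCfg (p := p) (inp := inp) (out := out) S (stepAux q v T) := by
  induction q generalizing v T with
  | push k f _ ih | pop k f _ ih => exact (congrArg _ (update_joinStk_inl _ _ _ _)).trans (ih _ _)
  | peek _ _ _ ih | load _ _ ih => exact ih _ _
  | branch f _ _ ihq ihr =>
    simp only [liftStmt, stepAux]
    cases f v
    · exact ihr _ _
    · exact ihq _ _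
  | goto | halt => rfl

theorem accFrom_liftCfg {S : K → List A} {t : ℕ} {c : M.Cfg} :
    (M.prepend p inp out).AccFrom t (liftCfg S c) ↔ M.AccFrom t c := by
  induction t generalizing c with
  | zero => simp [accFrom_zero, Accepting, liftCfg]
  | succ t ih =>
    obtain ⟨_ | l, v, T⟩ := c
    · exact accFrom_none.trans (by simp [accFrom_none])
    · rw [accFrom_some_succ, liftCfg, Option.map_some, accFrom_some_succ]
      refine exists_congr fun b => ?_
      rw [← ih, ← stepAux_liftStmt]

/-- The configuration of the machine that runs `p` and then `M`, while `p` is running or its output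
is being copied: `T` are the stacks of `M`, and `S` are the stacks of `p`. -/
def progCfg (l : M.PreΛ p) (T : ∀ k, List (M.Γ k)) (S : K → List A) :
    (M.prepend p inp out).Cfg :=
  ⟨some l, (none, M.init), joinStk T S⟩

theorem accFrom_progCfg_copy_nil {t : ℕ} {T : ∀ k, List (M.Γ k)} {S : K → List A}
    (hS : S out = []) :
    (M.prepend p inp out).AccFrom (t + 1) (progCfg (.inr none) T S) ↔
      M.AccFrom t ⟨some M.start, M.init, T⟩ := by
  rw [progCfg, accFrom_some_succ, ← accFrom_liftCfg (p := p) (inp := inp) (out := out) (S := S)]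
  simp only [exists_const, copyStmt, stepAux, update_joinStk_inr]
  have hupd : Function.update S out [] = S := by rw [← hS, Function.update_eq_self]
  simp [joinStk, hS, liftCfg, hupd]

theorem accFrom_progCfg_copy_cons {t : ℕ} {T : ∀ k, List (M.Γ k)} {S : K → List A} {a : A}
    {v : List A} (hS : S out = a :: v) :
    (M.prepend p inp out).AccFrom (t + 1) (progCfg (.inr none) T S) ↔
      (M.prepend p inp out).AccFrom t (progCfg (.inr none)
        (Function.update T M.inStack (M.inLetter a :: T M.inStack))
        (Function.update S out v)) := by
  rw [progCfg, accFrom_some_succ]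
  simp only [exists_const, copyStmt, stepAux, update_joinStk_inr]
  simp [joinStk, hS, progCfg, update_joinStk_inl]

theorem accFrom_progCfg_copy {t : ℕ} {T : ∀ k, List (M.Γ k)} {S : K → List A} :
    (M.prepend p inp out).AccFrom t (progCfg (.inr none) T S) ↔
      ∃ t', t = t' + (S out).length + 1 ∧ M.AccFrom t' ⟨some M.start, M.init,
        Function.update T M.inStack ((S out).reverse.map M.inLetter ++ T M.inStack)⟩ := by
  generalize hS : S out = v
  induction v generalizing t T S with
  | nil =>
    cases t with
    | zero => simpa [progCfg] using not_accFrom_some_zero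
    | succ t => simp [accFrom_progCfg_copy_nil hS]
  | cons a v ih =>
    cases t with
    | zero => simpa [progCfg] using not_accFrom_some_zero
    | succ t =>
      rw [accFrom_progCfg_copy_cons hS, ih (Function.update_self ..)]
      simp [← add_assoc]

theorem not_accFrom_stuck {t : ℕ} {a : A} {v : M.σ} {S : ∀ k, List (M.PreΓ K k)} :
    ¬ (M.prepend p inp out).AccFrom t ⟨none, (some a, v), S⟩ :=
  fun h => nomatch (accFrom_none.1 h).2.1

theorem accFrom_progCfg_instr {l : M.PreΛ p} {i : FlowInstr K A (M.PreΛ p)} {t : ℕ}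
    {T : ∀ k, List (M.Γ k)} {S : K → List A}
    (hi : ∀ b, (M.prepend p inp out).prog b l = M.instrStmt p b i) :
    (M.prepend p inp out).AccFrom (t + 1) (progCfg l T S) ↔
      ∃ l' S', i.Step S l' S' ∧ (M.prepend p inp out).AccFrom t (progCfg l' T S') := by
  rw [progCfg, accFrom_some_succ]
  refine (exists_congr fun b => iff_of_eq (congrArg (fun q => AccFrom _ t (stepAux q _ _))
    (hi b))).trans ?_
  cases i with
  | push k a x => simp [instrStmt, stepAux, FlowInstr.Step, update_joinStk_inr, joinStk, progCfg]
  | pop k a x =>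
    simp only [instrStmt, stepAux, FlowInstr.Step, update_joinStk_inr, exists_const]
    rcases hS : S k with _ | ⟨a', u⟩
    · simpa [joinStk, hS] using not_accFrom_stuck
    · rcases eq_or_ne a' a with rfl | ha
      · simp [joinStk, hS, progCfg]
      · simpa [joinStk, hS, ha] using not_accFrom_stuck
  | empty k x =>
    simp only [instrStmt, stepAux, FlowInstr.Step, exists_const]
    rcases hS : S k with _ | ⟨a', u⟩
    · simp [joinStk, hS, progCfg]
    · simpa [joinStk, hS] using not_accFrom_stuck
  | fail => simpa [instrStmt, stepAux, FlowInstr.Step] using not_accFrom_stuck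
  | fork x y => simp [instrStmt, stepAux, FlowInstr.Step, progCfg, or_and_right, exists_or]

theorem AccFrom.exists_step {l : M.PreΛ p} {i : FlowInstr K A (M.PreΛ p)} {t : ℕ}
    {T : ∀ k, List (M.Γ k)} {S : K → List A}
    (h : (M.prepend p inp out).AccFrom t (progCfg l T S))
    (hi : ∀ b, (M.prepend p inp out).prog b l = M.instrStmt p b i) :
    ∃ t' < t, ∃ l' S', i.Step S l' S' ∧ (M.prepend p inp out).AccFrom t' (progCfg l' T S') := by
  cases t with
  | zero => exact absurd h not_accFrom_some_zero
  | succ t => exact ⟨t, t.lt_succ_self, (accFrom_progCfg_instr hi).1 h⟩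

theorem AccWithin.of_step {l l' : M.PreΛ p} {i : FlowInstr K A (M.PreΛ p)} {t : ℕ}
    {T : ∀ k, List (M.Γ k)} {S S' : K → List A}
    (h : (M.prepend p inp out).AccWithin t (progCfg l' T S'))
    (hi : ∀ b, (M.prepend p inp out).prog b l = M.instrStmt p b i) (hS : i.Step S l' S') :
    (M.prepend p inp out).AccWithin (t + 1) (progCfg l T S) := by
  obtain ⟨t', ht', h⟩ := h
  exact ⟨t' + 1, Nat.succ_le_succ ht', (accFrom_progCfg_instr hi).2 ⟨l', S', hS, h⟩⟩

theorem AccFrom.exists_run {q : StackProg K A} {e : q.Lbl → M.PreΛ p} {x : M.PreΛ p}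
    (he : ∀ b l, (M.prepend p inp out).prog b (e l) = M.instrStmt p b (q.code e x l)) {t : ℕ}
    {T : ∀ k, List (M.Γ k)} {S : K → List A}
    (h : (M.prepend p inp out).AccFrom t (progCfg (e q.entry) T S)) :
    ∃ n S', q.Run n S S' ∧ ∃ t' < t, (M.prepend p inp out).AccFrom t' (progCfg x T S') := by
  induction q generalizing x t S with
  | push | pop | empty =>
    obtain ⟨t', ht', _, S', ⟨rfl, hS'⟩, h⟩ := h.exists_step fun b => he b _
    exact ⟨0, S', hS', t', ht', h⟩
  | fail =>
    obtain ⟨_, _, _, _, hS', _⟩ := h.exists_step fun b => he b StackProg.fail.entry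
    exact hS'.elim
  | seq q₁ q₂ ih₁ ih₂ =>
    obtain ⟨m, S₁, hm, t₁, ht₁, h₁⟩ := ih₁ (fun b l => he b (Sum.inl l : _ ⊕ _)) h
    obtain ⟨n, S₂, hn, t₂, ht₂, h₂⟩ := ih₂ (fun b l => he b (Sum.inr l : _ ⊕ _)) h₁
    exact ⟨max m n, S₂, ⟨S₁, hm.mono (le_max_left ..), hn.mono (le_max_right ..)⟩, t₂,
      ht₂.trans ht₁, h₂⟩
  | alt q₁ q₂ ih₁ ih₂ =>
    obtain ⟨t₁, ht₁, _, S₁, ⟨rfl | rfl, rfl⟩, h₁⟩ := h.exists_step fun b => he b (q₁.alt q₂).entry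
    · obtain ⟨n, S', hn, t', ht', h⟩ := ih₁ (fun b l => he b (some (.inl l) : Option _)) h₁
      exact ⟨n, S', .inl hn, t', ht'.trans ht₁, h⟩
    · obtain ⟨n, S', hn, t', ht', h⟩ := ih₂ (fun b l => he b (some (.inr l) : Option _)) h₁
      exact ⟨n, S', .inr hn, t', ht'.trans ht₁, h⟩
  | star q ih =>
    induction t using Nat.strong_induction_on generalizing S with
    | _ t iht =>
      obtain ⟨t₁, ht₁, _, S₁, ⟨rfl | rfl, rfl⟩, h₁⟩ := h.exists_step fun b => he b q.star.entry
      · exact ⟨0, S₁, ⟨0, le_rfl, rfl⟩, t₁, ht₁, h₁⟩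
      · obtain ⟨m, S₂, hm, t₂, ht₂, h₂⟩ := ih (fun b l => he b (some l : Option _)) h₁
        obtain ⟨n, S₃, hn, t₃, ht₃, h₃⟩ := iht t₂ (ht₂.trans ht₁) h₂
        exact ⟨_, S₃, hm.star_cons hn, t₃, ht₃.trans (ht₂.trans ht₁), h₃⟩

theorem AccWithin.of_run {q : StackProg K A} {e : q.Lbl → M.PreΛ p} {x : M.PreΛ p}
    (he : ∀ b l, (M.prepend p inp out).prog b (e l) = M.instrStmt p b (q.code e x l))
    {n t : ℕ} {T : ∀ k, List (M.Γ k)} {S S' : K → List A} (hq : q.Run n S S')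
    (h : (M.prepend p inp out).AccWithin t (progCfg x T S')) :
    (M.prepend p inp out).AccWithin (t + q.timeBound.eval n) (progCfg (e q.entry) T S) := by
  induction q generalizing x t S S' with
  | push | pop | empty =>
    rw [StackProg.timeBound, Polynomial.eval_one]
    exact h.of_step (fun b => he b _) ⟨rfl, hq⟩
  | fail => exact hq.elim
  | seq q₁ q₂ ih₁ ih₂ =>
    obtain ⟨S₁, hq₁, hq₂⟩ := hq
    have h₂ := ih₂ (fun b l => he b (Sum.inr l : _ ⊕ _)) hq₂ h
    refine (ih₁ (fun b l => he b (Sum.inl l : _ ⊕ _)) hq₁ h₂).mono ?_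
    simp only [StackProg.timeBound, Polynomial.eval_add]
    lia
  | alt q₁ q₂ ih₁ ih₂ =>
    simp only [StackProg.timeBound, Polynomial.eval_add, Polynomial.eval_one]
    rcases hq with hq | hq
    · have h₁ := ih₁ (fun b l => he b (some (.inl l) : Option _)) hq h
      exact (h₁.of_step (fun b => he b (q₁.alt q₂).entry) ⟨.inl rfl, rfl⟩).mono (by lia)
    · have h₂ := ih₂ (fun b l => he b (some (.inr l) : Option _)) hq h
      exact (h₂.of_step (fun b => he b (q₁.alt q₂).entry) ⟨.inr rfl, rfl⟩).mono (by lia)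
  | star q ih =>
    obtain ⟨m, hm, hq⟩ := hq
    have hexit := h.of_step (fun b => he b q.star.entry) ⟨.inl rfl, rfl⟩
    refine (hexit.of_iterate_relComp (d := q.timeBound.eval n + 1) (fun t S S' hS h => ?_)
      hq).mono ?_
    · exact (ih (fun b l => he b (some l : Option _)) hS h).of_step
        (fun b => he b q.star.entry) ⟨.inr rfl, rfl⟩
    · simp only [StackProg.timeBound, Polynomial.eval_add, Polynomial.eval_mul, Polynomial.eval_X,
        Polynomial.eval_one]
      nlinarith

theorem initial_prepend (w : List A) : (M.prepend p inp out).initial w =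
    progCfg (.inl p.entry) (fun _ => []) (Function.update (fun _ => []) inp w) := by
  have hnil : (fun _ => [] : ∀ k, List (M.PreΓ K k)) = joinStk (fun _ => []) fun _ => [] := by
    funext k
    cases k <;> rfl
  simp only [initial, progCfg]
  congr 1
  rw [← update_joinStk_inr, ← hnil]
  exact congrArg _ (List.map_id w)

end Prepend

theorem exists_prepend [Finite A] [Inhabited A] {K : Type} [DecidableEq K] [Finite K]
    (M : NTM A) (p : StackProg K A) (inp out : K) :
    ∃ N : NTM A,
      (∀ w t, N.AcceptsIn w t → ∃ n S t', p.Run n (Function.update (fun _ => []) inp w) S ∧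
        M.AcceptsIn (S out).reverse t') ∧
      (∀ w n S t, p.Run n (Function.update (fun _ => []) inp w) S →
        M.AcceptsIn (S out).reverse t →
        ∃ t' ≤ t + (S out).length + 1 + p.timeBound.eval n, N.AcceptsIn w t') := by
  have := Fintype.ofFinite A
  have := Fintype.ofFinite K
  have hp (b : Bool) (l : p.Lbl) : (M.prepend p inp out).prog b (.inl l) =
    M.instrStmt p b (p.code .inl (.inr none) l) := rfl
  refine ⟨M.prepend p inp out, fun w t h => ?_, fun w n S t hS h => ?_⟩
  · have h' : (M.prepend p inp out).AccFrom t ((M.prepend p inp out).initial w) := h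
    rw [initial_prepend] at h'
    obtain ⟨n, S, hS, t₁, -, h₁⟩ := h'.exists_run hp
    obtain ⟨t', -, h₂⟩ := accFrom_progCfg_copy.1 h₁
    rw [List.append_nil] at h₂
    exact ⟨n, S, t', hS, h₂⟩
  · have h' : M.AccFrom t (M.initial (S out).reverse) := h
    have hcopy : (M.prepend p inp out).AccWithin (t + (S out).length + 1)
        (progCfg (.inr none) (fun _ => []) S) :=
      ⟨_, le_rfl, accFrom_progCfg_copy.2 ⟨t, rfl, by rwa [List.append_nil]⟩⟩
    have hrun := hcopy.of_run hp hS
    rwa [← initial_prepend] at hrun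

end NTM

/-! ### Time bounds -/

theorem exists_eval_two_pow_le (r : Polynomial ℕ) :
    ∃ c, ∀ m, r.eval (2 ^ m) ≤ 2 ^ (c * (m + 1)) := by
  induction r using Polynomial.induction_on' with
  | add p q hp hq =>
    obtain ⟨c, hc⟩ := hp
    obtain ⟨d, hd⟩ := hq
    refine ⟨c + d + 1, fun m => ?_⟩
    calc (p + q).eval (2 ^ m) ≤ 2 ^ (c * (m + 1)) + 2 ^ (d * (m + 1)) := by
          rw [Polynomial.eval_add]
          exact add_le_add (hc m) (hd m)
      _ ≤ 2 ^ ((c + d) * (m + 1)) + 2 ^ ((c + d) * (m + 1)) := by gcongr <;> lia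
      _ = 2 ^ ((c + d) * (m + 1) + 1) := by ring
      _ ≤ 2 ^ ((c + d + 1) * (m + 1)) := by gcongr <;> lia
  | monomial i a =>
    refine ⟨a + i, fun m => ?_⟩
    calc (Polynomial.monomial i a).eval (2 ^ m) ≤ 2 ^ a * (2 ^ m) ^ i := by
          rw [Polynomial.eval_monomial]
          gcongr
          exact Nat.lt_two_pow_self.le
      _ = 2 ^ (a + m * i) := by rw [pow_add, pow_mul]
      _ ≤ 2 ^ ((a + i) * (m + 1)) := by gcongr <;> lia

theorem monotone_eval_nat (p : Polynomial ℕ) : Monotone fun n => p.eval n := by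
  intro m n hmn
  simp only [Polynomial.eval_eq_sum_range]
  gcongr

theorem two_pow_add_le (a b : ℕ) : 2 ^ a + b ≤ 2 ^ (a + b) :=
  calc 2 ^ a + b ≤ 2 ^ a * (b + 1) := by nlinarith [Nat.one_le_two_pow (n := a)]
    _ ≤ 2 ^ (a + b) := by
      rw [pow_add]
      gcongr
      exact Nat.lt_two_pow_self

theorem mem_twoNEXP_of_stackProg {A : Type} [Finite A] [Inhabited A] {K : Type} [DecidableEq K]
    [Finite K] {P P' : Language A} (hP : P ∈ NEXP) (p : StackProg K A) (inp out : K)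
    (b : Polynomial ℕ)
    (sound : ∀ w n s, p.Run n (Function.update (fun _ => []) inp w) s →
      (s out).reverse ∈ P → w ∈ P')
    (complete : ∀ w ∈ P', ∃ s,
      p.Run (2 ^ b.eval w.length) (Function.update (fun _ => []) inp w) s ∧
      (s out).length ≤ 2 ^ b.eval w.length ∧ (s out).reverse ∈ P) :
    P' ∈ TwoNEXP := by
  obtain ⟨q, M, hM, hMtime⟩ := hP
  obtain ⟨N, hN, hNtime⟩ := M.exists_prepend p inp out
  obtain ⟨c, hc⟩ := exists_eval_two_pow_le (q + Polynomial.X + 1 + p.timeBound)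
  refine ⟨Polynomial.C c * (b + 1), N, fun w t h => ?_, fun w hw => ?_⟩
  · obtain ⟨n, s, t', hs, ht'⟩ := hN w t h
    exact sound w n s hs (hM _ _ ht')
  · obtain ⟨s, hs, hlen, hsP⟩ := complete w hw
    obtain ⟨t, ht, hacc⟩ := hMtime _ hsP
    obtain ⟨t', ht', hacc'⟩ := hNtime w _ s t hs hacc
    refine ⟨t', ht'.trans ?_, hacc'⟩
    have hc' := hc (b.eval w.length)
    rw [List.length_reverse] at ht
    simp only [Polynomial.eval_add, Polynomial.eval_mul, Polynomial.eval_C, Polynomial.eval_X,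
      Polynomial.eval_one] at hc' ⊢
    set B := 2 ^ b.eval w.length
    calc t + (s out).length + 1 + p.timeBound.eval B
        ≤ 2 ^ q.eval B + (B + 1 + p.timeBound.eval B) := by
          have : 2 ^ q.eval (s out).length ≤ 2 ^ q.eval B :=
            Nat.pow_le_pow_right two_pos (monotone_eval_nat q hlen)
          lia
      _ ≤ 2 ^ (q.eval B + (B + 1 + p.timeBound.eval B)) := two_pow_add_le _ _
      _ ≤ 2 ^ 2 ^ (c * (b.eval w.length + 1)) := by
          gcongr
          · exact one_le_two
          · lia

/-! ### Programs that transport words between stacks -/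

local notation:60 p:61 ";;" q:60 => StackProg.seq p q

namespace StackProg

variable {K A : Type} [DecidableEq K] {n : ℕ} {k l : K} {s s' : K → List A}

@[simp] theorem run_push {a : A} :
    (push k a).Run n s s' ↔ s' = Function.update s k (a :: s k) := Iff.rfl

@[simp] theorem run_pop {a : A} :
    (pop k a).Run n s s' ↔ ∃ u, s k = a :: u ∧ s' = Function.update s k u := Iff.rfl

@[simp] theorem run_empty : (empty k).Run n s s' ↔ s k = [] ∧ s' = s := Iff.rfl

@[simp] theorem run_seq {p q : StackProg K A} :
    (p ;; q).Run n s s' ↔ ∃ s₁, p.Run n s s₁ ∧ q.Run n s₁ s' := Iff.rfl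

@[simp] theorem run_alt {p q : StackProg K A} :
    (p.alt q).Run n s s' ↔ p.Run n s s' ∨ q.Run n s s' := Iff.rfl

theorem run_star_of_layout {X ι : Type} {p : StackProg K A} {lay : X → K → List A} {P : ι → Prop}
    {R : List ι → X → X → Prop}
    (hp : ∀ x s', p.Run n (lay x) s' ↔ ∃ i x', P i ∧ R [i] x x' ∧ s' = lay x')
    (hnil : ∀ x x', R [] x x' ↔ x' = x)
    (hcons : ∀ i u x x', R (i :: u) x x' ↔ ∃ x₁, R [i] x x₁ ∧ R u x₁ x') (x : X)
    (s' : K → List A) :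
    p.star.Run n (lay x) s' ↔
      ∃ u x', u.length ≤ n ∧ (∀ i ∈ u, P i) ∧ R u x x' ∧ s' = lay x' := by
  suffices ∀ m, (Relation.Comp (p.Run n))^[m] Eq (lay x) s' ↔
      ∃ u x', u.length = m ∧ (∀ i ∈ u, P i) ∧ R u x x' ∧ s' = lay x' by
    simp only [Run, this]
    grind
  intro m
  induction m generalizing x with
  | zero => simp [hnil, eq_comm]
  | succ m ih =>
    rw [Function.iterate_succ_apply']
    constructor
    · rintro ⟨s₁, h₁, h⟩
      obtain ⟨i, x₁, hi, hR, rfl⟩ := (hp _ _).1 h₁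
      obtain ⟨u, x', rfl, hu, hRu, rfl⟩ := (ih _).1 h
      exact ⟨i :: u, x', rfl, List.forall_mem_cons.2 ⟨hi, hu⟩, (hcons ..).2 ⟨x₁, hR, hRu⟩, rfl⟩
    · rintro ⟨_ | ⟨i, u⟩, x', hm, hu, hR, rfl⟩
      · cases hm
      · obtain ⟨x₁, hR₁, hR⟩ := (hcons ..).1 hR
        obtain ⟨hi, hu⟩ := List.forall_mem_cons.1 hu
        exact ⟨lay x₁, (hp ..).2 ⟨i, x₁, hi, hR₁, rfl⟩,
          (ih _).2 ⟨u, x', Nat.succ.inj hm, hu, hR, rfl⟩⟩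

/-- The program that does nothing. -/
def skip : StackProg K A := fail.star

@[simp] theorem run_skip : (skip : StackProg K A).Run n s s' ↔ s' = s := by
  constructor
  · rintro ⟨_ | m, -, h⟩
    · exact h.symm
    · rw [Function.iterate_succ_apply'] at h
      obtain ⟨_, h, _⟩ := h
      exact h.elim
  · rintro rfl
    exact ⟨0, n.zero_le, rfl⟩

/-- `rep m p` runs `p` exactly `m` times. -/
def rep : ℕ → StackProg K A → StackProg K A
  | 0, _ => skip
  | m + 1, p => p ;; rep m p

/-- `any f` runs one of the programs `f i`. -/
noncomputable def any {ι : Type} [Finite ι] (f : ι → StackProg K A) : StackProg K A :=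
  ((Set.toFinite (Set.range f)).toFinset.toList).foldr alt fail

@[simp] theorem run_any {ι : Type} [Finite ι] {f : ι → StackProg K A} :
    (any f).Run n s s' ↔ ∃ i, (f i).Run n s s' := by
  have hfoldr (u : List (StackProg K A)) :
      (u.foldr alt fail).Run n s s' ↔ ∃ p ∈ u, p.Run n s s' := by
    induction u with
    | nil => simp [Run]
    | cons p u ih => simp [ih]
  simp [any, hfoldr]

/-- `R u` describes the effect of processing the word `u` letter by letter. -/
structure IsAction (R : List A → (K → List A) → (K → List A) → Prop) : Prop where
  nil : ∀ s s', R [] s s' ↔ s' = s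
  append : ∀ u v s s', R (u ++ v) s s' ↔ ∃ s₁, R u s s₁ ∧ R v s₁ s'

namespace IsAction

variable {ι : Type} {R : List A → (K → List A) → (K → List A) → Prop} {p : StackProg K A}
  {P : ι → Prop} {e : ι → List A}

theorem run_star (hR : IsAction R) (hp : ∀ s s', p.Run n s s' ↔ ∃ i, P i ∧ R (e i) s s') :
    p.star.Run n s s' ↔ ∃ u : List ι, u.length ≤ n ∧ (∀ i ∈ u, P i) ∧ R (u.flatMap e) s s' := by
  have := run_star_of_layout (n := n) (lay := id) (P := P) (R := fun u => R (u.flatMap e))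
    (p := p) (by simp [hp]) (by simp [hR.nil]) (by simp [hR.append]) s s'
  simpa using this

theorem run_rep (hR : IsAction R) (hp : ∀ s s', p.Run n s s' ↔ ∃ i, P i ∧ R (e i) s s') {m : ℕ} :
    (rep m p).Run n s s' ↔ ∃ x : Fin m → ι, (∀ i, P (x i)) ∧ R ((List.ofFn x).flatMap e) s s' := by
  induction m generalizing s with
  | zero => simp [rep, hR.nil]
  | succ m ih =>
    simp only [rep, run_seq, hp, ih]
    simp only [Fin.exists_fin_succ_pi, Fin.forall_fin_succ, List.ofFn_succ, Fin.cons_zero,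
      Fin.cons_succ, List.flatMap_cons, hR.append]
    grind

end IsAction

/-- `Emit l u s s'`: the letters of `u` are pushed one by one on the stack `l`. -/
def Emit (l : K) (u : List A) (s s' : K → List A) : Prop :=
  s' = Function.update s l (u.reverse ++ s l)

/-- `Transfer k l u v s s'`: the word `u` is popped off the stack `k`, and the letters of `v` are
pushed one by one on the stack `l`. -/
def Transfer (k l : K) (u v : List A) (s s' : K → List A) : Prop :=
  ∃ r, s k = u ++ r ∧ Emit l v (Function.update s k r) s'

theorem isAction_emit : IsAction (Emit (A := A) l) where
  nil s s' := by simp [Emit]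
  append u v s s' := by simp [Emit]

theorem isAction_transfer (hkl : k ≠ l) (φ : A → A) :
    IsAction fun u => Transfer k l u (u.map φ) where
  nil s s' := by simp [Transfer, Emit]
  append u v s s' := by
    simp only [Transfer, Emit, List.map_append, List.reverse_append, List.append_assoc]
    constructor
    · rintro ⟨r, hr, rfl⟩
      refine ⟨_, ⟨v ++ r, hr, rfl⟩, r, ?_, ?_⟩
      · simp [hkl]
      · simp [hkl.symm, Function.update_comm hkl]
    · rintro ⟨s₁, ⟨r, hr, rfl⟩, r', hr', rfl⟩
      refine ⟨r', ?_, ?_⟩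
      · simp_all
      · simp [hkl.symm, Function.update_comm hkl]

/-- The program that replaces a letter `a` on top of the stack `k` by a letter `b` on top of the
stack `l`. -/
def move1 (a b : A) (k l : K) : StackProg K A := pop k a ;; push l b

theorem run_move1 {a b : A} : (move1 a b k l).Run n s s' ↔ Transfer k l [a] [b] s s' := by
  simp [move1, Transfer, Emit]

/-- The program that moves some letters with the property `P` from the stack `k` to the stack `l`,
applying `φ` to each of them. -/
noncomputable def move [Finite A] (P : A → Prop) (φ : A → A) (k l : K) : StackProg K A :=
  (any fun a : {a // P a} => move1 (a : A) (φ a) k l).star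

theorem run_move [Finite A] (hkl : k ≠ l) {P : A → Prop} {φ : A → A} :
    (move P φ k l).Run n s s' ↔
      ∃ u : List A, u.length ≤ n ∧ (∀ a ∈ u, P a) ∧ Transfer k l u (u.map φ) s s' := by
  have := (isAction_transfer (A := A) hkl φ).run_star (n := n) (s := s) (s' := s') (P := P)
    (e := fun a => [a]) (p := any fun a : {a // P a} => move1 (a : A) (φ a) k l)
    (by simp [run_move1])
  simpa [move] using this

/-- The program that moves all letters of the stack `k` to the stack `l`. -/
noncomputable def moveAll [Finite A] (k l : K) : StackProg K A :=
  move (fun _ => True) id k l ;; empty k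

theorem run_moveAll [Finite A] (hkl : k ≠ l) :
    (moveAll k l).Run n s s' ↔ (s k).length ≤ n ∧
      s' = Function.update (Function.update s k []) l ((s k).reverse ++ s l) := by
  simp only [moveAll, run_seq, run_move hkl, run_empty, Transfer, Emit, List.map_id]
  constructor
  · rintro ⟨_, ⟨u, hu, -, r, hr, rfl⟩, hs, rfl⟩
    obtain rfl : r = [] := by simpa [hkl] using hs
    rw [List.append_nil] at hr
    simp [hr, hu, hkl.symm]
  · rintro ⟨hn, rfl⟩
    exact ⟨_, ⟨s k, hn, by simp, [], by simp, rfl⟩, by simp [hkl], by simp [hkl.symm]⟩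

end StackProg

/-! ### Unique readability of the inputs -/

section UniqueReadability

variable {ι α : Type*}

theorem append_cons_inj_of_notMem_left {a : α} {x x' y y' : List α} (hx : a ∉ x) (hx' : a ∉ x') :
    x ++ a :: y = x' ++ a :: y' ↔ x = x' ∧ y = y' := by
  induction x generalizing x' with
  | nil => cases x' <;> grind
  | cons b x ih => cases x' <;> grind

theorem flatMap_cons_injective {P : α → Prop} {mark : ι → α} {body : ι → List α}
    (hmark : ∀ i, ¬ P (mark i)) (hbody : ∀ i, ∀ a ∈ body i, P a)
    (hinj : ∀ i j, mark i = mark j → body i = body j → i = j) :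
    Function.Injective fun l : List ι => l.flatMap fun i => mark i :: body i := by
  classical
  have hnil (l : List ι) : (l.flatMap fun i => mark i :: body i).takeWhile P = [] := by
    cases l <;> simp [hmark]
  have htake (i : ι) (l : List ι) :
      (body i ++ l.flatMap fun i => mark i :: body i).takeWhile P = body i := by
    rw [List.takeWhile_append_of_pos (by simpa using hbody i), hnil, List.append_nil]
  intro l
  induction l with
  | nil =>
    rintro (_ | ⟨j, l'⟩) h
    · rfl
    · cases h
  | cons i l ih =>
    rintro (_ | ⟨j, l'⟩) h
    · cases h
    · obtain ⟨hm, ht⟩ := List.cons.inj h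
      have hb : body i = body j := by
        rw [← htake i l, ← htake j l']
        exact congrArg _ ht
      change body i ++ _ = body j ++ _ at ht
      rw [hinj i j hm hb, ih (List.append_cancel_left (hb ▸ ht))]

end UniqueReadability

namespace MissingAnswer

variable {Symb : Type} {S : Schema}

instance Letter.finite {Rel : Type} [Finite Symb] [Finite Rel] : Finite (Letter Symb Rel) := by
  refine Finite.of_injective (β := (Symb ⊕ Rel) ⊕ (Bool ⊕ Bool)) (fun a => match a with
    | .sym s => .inl (.inl s)
    | .rel r => .inl (.inr r)
    | .const => .inr (.inl true)
    | .sep => .inr (.inl false)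
    | .bit b => .inr (.inr b)) ?_
  rintro (_ | _ | _ | _ | _) (_ | _ | _ | _ | _) h <;> simp_all

instance Letter.inhabited {Rel : Type} : Inhabited (Letter Symb Rel) := ⟨.sep⟩

/-- The word for a single fact. -/
def encFact (f : Fact S) : List (Letter Symb S.Rel) := Letter.rel f.1 :: encTuple f.2

theorem encFacts_nil : (encFacts [] : List (Letter Symb S.Rel)) = [] := rfl

theorem encFacts_cons (f : Fact S) (F : List (Fact S)) :
    (encFacts (f :: F) : List (Letter Symb S.Rel)) = encFact f ++ encFacts F := rfl

theorem encFacts_append (F G : List (Fact S)) :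
    (encFacts (F ++ G) : List (Letter Symb S.Rel)) = encFacts F ++ encFacts G :=
  List.flatMap_append

theorem encBits_injective :
    Function.Injective (encBits : List Bool → List (Letter Symb S.Rel)) :=
  List.map_injective_iff.2 fun _ _ => Letter.bit.inj

theorem eq_const_or_bit_of_mem_encTuple {n : ℕ} {a : Fin n → Dom} {x : Letter Symb S.Rel}
    (h : x ∈ encTuple a) : x = .const ∨ ∃ b, x = .bit b := by
  simp only [encTuple, encConst, encBits, List.mem_flatMap, List.mem_cons, List.mem_map] at h
  grind

theorem sep_notMem_encTuple {n : ℕ} {a : Fin n → Dom} :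
    (.sep : Letter Symb S.Rel) ∉ encTuple a := by
  simp [encTuple, encConst, encBits]

theorem sep_notMem_encFacts {F : List (Fact S)} : (.sep : Letter Symb S.Rel) ∉ encFacts F := by
  simp [encFacts, sep_notMem_encTuple]

theorem sep_notMem_encQuery {Q : List (Symb ⊕ Dom)} :
    (.sep : Letter Symb S.Rel) ∉ encQuery Q := by
  simp [encQuery, encConst, encBits]

theorem encTuple_injective {n : ℕ} :
    Function.Injective (encTuple : (Fin n → Dom) → List (Letter Symb S.Rel)) :=
  (flatMap_cons_injective (ι := Dom) (P := fun x : Letter Symb S.Rel => ∃ b, x = .bit b)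
    (mark := fun _ => .const) (body := encBits) (by simp)
    (fun _ _ h => (List.mem_map.1 h).imp fun _ h => h.2.symm)
    (fun _ _ _ h => encBits_injective h)).comp List.ofFn_injective

theorem encFacts_injective :
    Function.Injective (encFacts : List (Fact S) → List (Letter Symb S.Rel)) := by
  refine flatMap_cons_injective (ι := Fact S)
    (P := fun x : Letter Symb S.Rel => x = .const ∨ ∃ b, x = .bit b)
    (mark := fun f => .rel f.1) (body := fun f => encTuple f.2) (by simp)
    (fun _ _ => eq_const_or_bit_of_mem_encTuple) ?_
  rintro ⟨r, a⟩ ⟨r', b⟩ hr h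
  obtain rfl : r = r' := Letter.rel.inj hr
  exact congrArg _ (encTuple_injective h)

theorem encEvalInput_inj {Q : List (Symb ⊕ Dom)} {F G : List (Fact S)} {n : ℕ} {a : Fin n → Dom}
    {x y : List (Letter Symb S.Rel)} (hx : .sep ∉ x) :
    x ++ .sep :: (encFacts G ++ .sep :: y) = encEvalInput Q F a ↔
      x = encQuery Q ∧ G = F ∧ y = encTuple a := by
  rw [encEvalInput, append_cons_inj_of_notMem_left hx sep_notMem_encQuery,
    append_cons_inj_of_notMem_left sep_notMem_encFacts sep_notMem_encFacts,
    encFacts_injective.eq_iff]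

/-! ### Lengths of the encodings -/

theorem length_le_length_flatMap {ι α : Type*} {g : ι → List α} {l : List ι} {i : ι} (hi : i ∈ l) :
    (g i).length ≤ (l.flatMap g).length :=
  (List.sublist_flatten_of_mem (List.mem_map_of_mem hi)).length_le

theorem length_encConst (d : Dom) :
    (encConst d : List (Letter Symb S.Rel)).length = d.length + 1 := by
  simp [encConst, encBits]

theorem length_le_length_encQuery {Q : List (Symb ⊕ Dom)} {d : Dom} (h : d ∈ adom Q) :
    d.length ≤ (encQuery Q : List (Letter Symb S.Rel)).length := by
  have := length_le_length_flatMap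
    (g := Sum.elim (fun s => [(.sym s : Letter Symb S.Rel)]) encConst) h
  rw [Sum.elim_inr, length_encConst] at this
  exact (Nat.le_succ _).trans this

theorem length_le_length_encTuple {n : ℕ} (a : Fin n → Dom) (i : Fin n) :
    (a i).length ≤ (encTuple a : List (Letter Symb S.Rel)).length := by
  have := length_le_length_flatMap (g := (encConst : Dom → List (Letter Symb S.Rel)))
    (List.mem_ofFn.2 ⟨i, rfl⟩ : a i ∈ List.ofFn a)
  rw [length_encConst] at this
  exact (Nat.le_succ _).trans this

theorem length_encTuple_le {n l : ℕ} {a : Fin n → Dom} (h : ∀ i, (a i).length ≤ l) :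
    (encTuple a : List (Letter Symb S.Rel)).length ≤ n * (l + 1) := by
  have := List.sum_le_card_nsmul ((List.ofFn a).map fun d =>
    (encConst d : List (Letter Symb S.Rel)).length) (l + 1) (by simpa [length_encConst] using h)
  simpa [encTuple, List.length_flatMap] using this

/-- A fact all of whose constants have length at most `n`. -/
def Fact.IsShort (n : ℕ) (f : Fact S) : Prop := ∀ i, (f.2 i).length ≤ n

theorem Fact.isShort_of_length_encFact_le {n : ℕ} {f : Fact S}
    (h : (encFact f : List (Letter Symb S.Rel)).length ≤ n) : f.IsShort n := fun i =>
  (length_le_length_encTuple f.2 i).trans ((Nat.le_succ _).trans h)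

theorem Fact.IsShort.length_encFact_le {m n : ℕ} {f : Fact S} (hf : f.IsShort n)
    (hm : S.arity f.1 ≤ m) :
    (encFact f : List (Letter Symb S.Rel)).length ≤ m * (n + 1) + 1 :=
  Nat.succ_le_succ ((length_encTuple_le hf).trans (Nat.mul_le_mul_right _ hm))

theorem length_encFact_le_length_encFacts {F : List (Fact S)} {f : Fact S} (hf : f ∈ F) :
    (encFact f : List (Letter Symb S.Rel)).length ≤
      (encFacts F : List (Letter Symb S.Rel)).length :=
  length_le_length_flatMap (g := fun f : Fact S => (encFact f : List (Letter Symb S.Rel))) hf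

theorem length_le_length_encFacts (F : List (Fact S)) :
    F.length ≤ (encFacts F : List (Letter Symb S.Rel)).length := by
  induction F with
  | nil => exact le_rfl
  | cons f F ih => simpa [encFacts_cons, encFact] using Nat.le_add_left_of_le ih

/-! ### Binary counters -/

/-- The number with the binary digits `b`, least significant digit first. -/
def bitsVal (b : List Bool) : ℕ := Nat.ofDigits 2 (b.map Bool.toNat)

theorem digits_two_eq_map_toNat (k : ℕ) : Nat.digits 2 k = k.bits.map Bool.toNat := by
  rw [Nat.digits_two_eq_bits]
  exact List.map_congr_left fun b _ => by cases b <;> rfl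

theorem bitsVal_bits (k : ℕ) : bitsVal k.bits = k := by
  rw [bitsVal, ← digits_two_eq_map_toNat, Nat.ofDigits_digits]

theorem bitsVal_lt (b : List Bool) : bitsVal b < 2 ^ b.length := by
  simpa [bitsVal] using Nat.ofDigits_lt_base_pow_length (b := 2) (l := b.map Bool.toNat) one_lt_two
    (List.forall_mem_map.2 fun a _ => a.toNat_lt)

/-- A binary numeral without leading zeros; the last digit is the most significant one. -/
def IsCanonical (b : List Bool) : Prop := b = [] ∨ ∃ c, b = c ++ [true]

theorem isCanonical_bits (k : ℕ) : IsCanonical k.bits := by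
  refine (List.eq_nil_or_concat' k.bits).imp_right ?_
  rintro ⟨c, a, h⟩
  have hk : k ≠ 0 := by
    rintro rfl
    simp at h
  have := Nat.getLast_digit_ne_zero 2 hk
  simp only [digits_two_eq_map_toNat, h, List.map_append] at this
  exact ⟨c, by cases a <;> simp_all⟩

theorem bits_bitsVal {b : List Bool} (hb : IsCanonical b) : (bitsVal b).bits = b := by
  have hinj : Function.Injective Bool.toNat := by decide
  apply List.map_injective_iff.2 hinj
  rw [← digits_two_eq_map_toNat, bitsVal, Nat.digits_ofDigits 2 one_lt_two]
  · exact List.forall_mem_map.2 fun a _ => a.toNat_lt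
  · rcases hb with rfl | ⟨c, rfl⟩ <;> simp

/-- `b'` arises from the binary counter `b` by subtracting one, without changing its length. -/
def IsDecr (b b' : List Bool) : Prop :=
  ∃ i r, b = List.replicate i false ++ true :: r ∧ b' = List.replicate i true ++ false :: r

theorem IsDecr.length_eq {b b' : List Bool} (h : IsDecr b b') : b'.length = b.length := by
  obtain ⟨i, r, rfl, rfl⟩ := h
  simp

theorem bitsVal_cons (a : Bool) (b : List Bool) : bitsVal (a :: b) = a.toNat + 2 * bitsVal b := by
  simp [bitsVal, Nat.ofDigits_cons]

theorem IsDecr.bitsVal_eq {b b' : List Bool} (h : IsDecr b b') : bitsVal b = bitsVal b' + 1 := by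
  obtain ⟨i, r, rfl, rfl⟩ := h
  induction i with
  | zero => simp [bitsVal_cons, add_comm]
  | succ i ih =>
    simp only [List.replicate_succ, List.cons_append, bitsVal_cons, ih, Bool.toNat_false,
      Bool.toNat_true]
    ring

theorem exists_isDecr {b : List Bool} (hb : bitsVal b ≠ 0) : ∃ b', IsDecr b b' := by
  induction b with
  | nil => exact absurd rfl hb
  | cons a b ih =>
    cases a with
    | true => exact ⟨_, 0, b, rfl, rfl⟩
    | false =>
      obtain ⟨_, i, r, rfl, rfl⟩ := ih (by simpa [bitsVal_cons] using hb)
      exact ⟨_, i + 1, r, rfl, rfl⟩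

open StackProg

section FactPrograms

variable {Symb K : Type} {S : Schema} [DecidableEq K] {n : ℕ}
  {R : List (Letter Symb S.Rel) → (K → List (Letter Symb S.Rel)) →
    (K → List (Letter Symb S.Rel)) → Prop}
  {wr : Letter Symb S.Rel → StackProg K (Letter Symb S.Rel)}
  {s s' : K → List (Letter Symb S.Rel)}

/-- The program that chooses a constant and processes its word by means of the programs `wr`. -/
noncomputable def constProg (wr : Letter Symb S.Rel → StackProg K (Letter Symb S.Rel)) :
    StackProg K (Letter Symb S.Rel) :=
  wr .const ;; (any fun b => wr (.bit b)).star

/-- The program that chooses a fact and processes its word by means of the programs `wr`. -/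
noncomputable def factProg (wr : Letter Symb S.Rel → StackProg K (Letter Symb S.Rel)) :
    StackProg K (Letter Symb S.Rel) :=
  any fun r => wr (.rel r) ;; rep (S.arity r) (constProg wr)

theorem run_constProg (hR : IsAction R) (hwr : ∀ a s s', (wr a).Run n s s' ↔ R [a] s s') :
    (constProg wr).Run n s s' ↔ ∃ d : Dom, d.length ≤ n ∧ R (encConst d) s s' := by
  have hcons (d : Dom) : encConst d = ([.const] : List (Letter Symb S.Rel)) ++
      d.flatMap fun b => [.bit b] := by
    simp [encConst, encBits, ← List.map_eq_flatMap]
  have hstar (s : K → List (Letter Symb S.Rel)) := hR.run_star (n := n) (s := s) (s' := s')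
    (p := any fun b => wr (.bit b)) (P := fun _ => True) (e := fun b => [.bit b]) (by simp [hwr])
  simp only [constProg, run_seq, hwr, hstar, hcons, hR.append]
  grind

theorem run_factProg (hR : IsAction R) (hwr : ∀ a s s', (wr a).Run n s s' ↔ R [a] s s') :
    (factProg wr).Run n s s' ↔ ∃ f : Fact S, f.IsShort n ∧ R (encFact f) s s' := by
  have hcons (f : Fact S) : encFact f = ([.rel f.1] : List (Letter Symb S.Rel)) ++
      (List.ofFn f.2).flatMap encConst := rfl
  simp only [factProg, run_any, run_seq, hwr, hR.run_rep fun _ _ => run_constProg hR hwr, hcons,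
    hR.append, Fact.IsShort, Sigma.exists]
  grind

theorem run_star_factProg (hR : IsAction R) (hwr : ∀ a s s', (wr a).Run n s s' ↔ R [a] s s') :
    (factProg wr).star.Run n s s' ↔
      ∃ F : List (Fact S), F.length ≤ n ∧ (∀ f ∈ F, f.IsShort n) ∧ R (encFacts F) s s' :=
  hR.run_star fun _ _ => run_factProg hR hwr

end FactPrograms

/-! ### The program that guesses an update -/

/-- The stacks of the program. The input is read from `inp`, where finally the counter remains, and
the output is written on `out`; `facts` holds the current facts and `rest` the tuple of constants;
`tmp`, `guess` and `aux` are used by subprograms only. -/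
inductive Stk : Type
  | inp | out | facts | rest | tmp | guess | aux
  deriving DecidableEq

instance Stk.finite : Finite Stk :=
  .of_finite_univ <| .subset (Set.toFinite {inp, out, facts, rest, tmp, guess, aux}) fun k _ => by
    cases k <;> simp

/-- The stacks with the given contents, the top of a stack being the first letter. -/
@[simp] def layout {A : Type} (i o f r t g a : List A) : Stk → List A
  | .inp => i
  | .out => o
  | .facts => f
  | .rest => r
  | .tmp => t
  | .guess => g
  | .aux => a

section Layout

variable {A : Type} {i o f r t g a : List A} {x : List A}

theorem update_nil_inp : Function.update (fun _ => []) .inp x = layout x [] [] [] [] [] [] := by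
  funext k
  cases k <;> rfl

@[simp] theorem update_layout_inp :
    Function.update (layout i o f r t g a) .inp x = layout x o f r t g a := by
  funext k
  cases k <;> rfl

@[simp] theorem update_layout_out :
    Function.update (layout i o f r t g a) .out x = layout i x f r t g a := by
  funext k
  cases k <;> rfl

@[simp] theorem update_layout_facts :
    Function.update (layout i o f r t g a) .facts x = layout i o x r t g a := by
  funext k
  cases k <;> rfl

@[simp] theorem update_layout_rest :
    Function.update (layout i o f r t g a) .rest x = layout i o f x t g a := by
  funext k
  cases k <;> rfl

@[simp] theorem update_layout_tmp :
    Function.update (layout i o f r t g a) .tmp x = layout i o f r x g a := by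
  funext k
  cases k <;> rfl

@[simp] theorem update_layout_guess :
    Function.update (layout i o f r t g a) .guess x = layout i o f r t x a := by
  funext k
  cases k <;> rfl

@[simp] theorem update_layout_aux :
    Function.update (layout i o f r t g a) .aux x = layout i o f r t g x := by
  funext k
  cases k <;> rfl

end Layout

section Programs

variable {Symb : Type} {S : Schema} {n : ℕ} {i o f r g a : List (Letter Symb S.Rel)}
  {s' : Stk → List (Letter Symb S.Rel)}

/-- The program that moves a fact from the stack `k` to the stack `l`. -/
noncomputable def moveFact {K : Type} (k l : K) : StackProg K (Letter Symb S.Rel) :=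
  factProg fun a => move1 a a k l

theorem run_moveFact {k l : Stk} (hkl : k ≠ l) {s s' : Stk → List (Letter Symb S.Rel)} :
    (moveFact k l).Run n s s' ↔
      ∃ f : Fact S, f.IsShort n ∧ Transfer k l (encFact f) (encFact f) s s' := by
  have := run_factProg (n := n) (s := s) (s' := s')
    (isAction_transfer (A := Letter Symb S.Rel) hkl id) (wr := fun a => move1 a a k l)
    fun _ _ _ => run_move1
  simpa [moveFact] using this

theorem run_star_moveFact {k l : Stk} (hkl : k ≠ l) {s s' : Stk → List (Letter Symb S.Rel)} :
    (moveFact k l).star.Run n s s' ↔ ∃ F : List (Fact S), F.length ≤ n ∧ (∀ f ∈ F, f.IsShort n) ∧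
      Transfer k l (encFacts F) (encFacts F) s s' := by
  have := run_star_factProg (n := n) (s := s) (s' := s')
    (isAction_transfer (A := Letter Symb S.Rel) hkl id) (wr := fun a => move1 a a k l)
    fun _ _ _ => run_move1
  simpa [moveFact] using this

variable (Symb S) in
/-- The program that inserts a fact. -/
noncomputable def insertFact : StackProg Stk (Letter Symb S.Rel) := factProg (push .facts)

theorem run_insertFact {F : List (Fact S)} :
    (insertFact Symb S).Run n (layout i o (encFacts F).reverse r [] g a) s' ↔
      ∃ d : Fact S, d.IsShort n ∧ s' = layout i o (encFacts (F ++ [d])).reverse r [] g a := by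
  have := run_factProg (isAction_emit (l := Stk.facts)) (n := n) (s' := s')
    (s := layout i o (encFacts F).reverse r [] g a) fun _ _ _ => run_push
  simpa [insertFact, Emit, encFacts, encFact] using this

theorem forall_mem_eq_bit_iff {u : List (Letter Symb S.Rel)} :
    (∀ a ∈ u, ∃ b, a = .bit b) ↔ ∃ b, u = encBits b := by
  have := Set.ext_iff.1 (Set.range_list_map (.bit : Bool → Letter Symb S.Rel)) u
  simpa [encBits, eq_comm] using this.symm

variable [Finite Symb]

variable (Symb S) in
/-- The program that checks that `inp` holds the bits of a canonical numeral. -/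
noncomputable def checkCanonical : StackProg Stk (Letter Symb S.Rel) :=
  (empty .inp).alt (move (fun a => ∃ b, a = .bit b) id .inp .tmp ;;
    move1 (.bit true) (.bit true) .inp .tmp ;; empty .inp ;; moveAll .tmp .inp)

theorem run_checkCanonical :
    (checkCanonical Symb S).Run n (layout i o f r [] g a) s' ↔
      ∃ b, IsCanonical b ∧ b.length ≤ n ∧ i = encBits b ∧
        s' = layout (encBits b) o f r [] g a := by
  have hmove (s s' : Stk → List (Letter Symb S.Rel)) :
      (move (fun a => ∃ b, a = .bit b) id .inp .tmp).Run n s s' ↔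
        ∃ b : List Bool, b.length ≤ n ∧ Transfer .inp .tmp (encBits b) (encBits b) s s' := by
    simp only [run_move (K := Stk) (k := .inp) (l := .tmp) (by decide), forall_mem_eq_bit_iff,
      List.map_id]
    constructor
    · rintro ⟨_, hu, ⟨b, rfl⟩, h⟩
      exact ⟨b, by simpa [encBits] using hu, h⟩
    · rintro ⟨b, hb, h⟩
      exact ⟨_, by simpa [encBits] using hb, ⟨b, rfl⟩, h⟩
  simp only [checkCanonical, run_alt, run_seq, hmove]
  simp only [run_empty, layout, Transfer, encBits, Emit, update_layout_inp, ne_eq, reduceCtorEq,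
    not_false_eq_true, Function.update_of_ne, List.append_nil, update_layout_tmp, run_move1,
    List.cons_append, List.nil_append, List.reverse_cons, List.reverse_nil, run_moveAll,
    ↓existsAndEq, and_true, Function.update_self, List.length_cons, Order.add_one_le_iff,
    Function.update_idem, List.append_assoc, true_and, List.length_reverse, List.length_map,
    List.reverse_reverse, IsCanonical, exists_eq_or_imp, List.length_nil, zero_le, List.map_nil,
    List.length_append, zero_add, List.map_append, List.map_cons]
  grind

variable (Symb S) in
/-- The program that takes the input apart. -/
noncomputable def readInput : StackProg Stk (Letter Symb S.Rel) :=
  move (· ≠ .sep) id .inp .out ;; move1 .sep .sep .inp .out ;;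
  (moveFact .inp .facts).star ;; pop .inp .sep ;;
  move (· ≠ .sep) id .inp .rest ;; pop .inp .sep ;; checkCanonical Symb S

theorem run_readInput {w : List (Letter Symb S.Rel)} :
    (readInput Symb S).Run n (layout w [] [] [] [] [] []) s' ↔ ∃ x F y b,
      (x.length ≤ n ∧ .sep ∉ x) ∧ (F.length ≤ n ∧ ∀ f ∈ F, f.IsShort n) ∧
      (y.length ≤ n ∧ .sep ∉ y) ∧ IsCanonical b ∧ b.length ≤ n ∧
      w = x ++ .sep :: (encFacts F ++ .sep :: (y ++ .sep :: encBits b)) ∧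
      s' = layout (encBits b) (.sep :: x.reverse) (encFacts F).reverse y.reverse [] [] [] := by
  simp only [readInput, ne_eq, run_seq, reduceCtorEq, not_false_eq_true, run_move, Transfer, layout,
    Emit, update_layout_inp, List.map_id_fun, id_eq, Function.update_of_ne, List.append_nil,
    update_layout_out, run_move1, List.cons_append, List.nil_append, List.reverse_cons,
    List.reverse_nil, run_star_moveFact, run_pop, ↓existsAndEq, and_true, Function.update_self,
    true_and, Function.update_idem, update_layout_facts, update_layout_rest, run_checkCanonical,
    exists_and_left]
  grind

variable (Symb S) in
/-- The program that subtracts one from the counter on `inp`. -/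
noncomputable def decr : StackProg Stk (Letter Symb S.Rel) :=
  move (· = .bit false) (fun _ => .bit true) .inp .tmp ;;
  pop .inp (.bit true) ;; push .inp (.bit false) ;; moveAll .tmp .inp

theorem run_decr {b : List Bool} (hb : b.length ≤ n) :
    (decr Symb S).Run n (layout (encBits b) o f r [] g a) s' ↔
      ∃ b', IsDecr b b' ∧ s' = layout (encBits b') o f r [] g a := by
  simp only [decr, run_seq, run_move (K := Stk) (k := .inp) (l := .tmp) (by decide),
    ← List.eq_replicate_length, IsDecr]
  simp only [Transfer, layout, Emit, update_layout_inp, List.map_const', List.reverse_replicate,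
    ne_eq, reduceCtorEq, not_false_eq_true, Function.update_of_ne, List.append_nil,
    update_layout_tmp, run_pop, run_push, run_moveAll, exists_eq_left, Function.update_self,
    ↓existsAndEq, and_true, Function.update_idem, List.length_replicate, true_and]
  constructor
  · rintro ⟨u, c, ⟨-, hu, h⟩, -, rfl⟩
    rw [hu, ← List.map_replicate, encBits] at h
    obtain ⟨v, c', rfl, hv, hc⟩ := List.map_eq_append_iff.1 h
    obtain rfl := encBits_injective hv
    obtain ⟨_, c, rfl, hb, rfl⟩ := List.map_eq_cons_iff.1 hc
    obtain rfl := Letter.bit.inj hb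
    exact ⟨u.length, c, rfl, by simp [encBits]⟩
  · rintro ⟨j, c, rfl, rfl⟩
    have hj : j ≤ n := by
      rw [List.length_append, List.length_replicate] at hb
      exact (Nat.le_add_right ..).trans hb
    exact ⟨List.replicate j (.bit false), encBits c, by simpa [encBits] using hj⟩

variable (Symb S) in
/-- The program that removes the word whose reversal is on `aux` from the top of `tmp`. -/
noncomputable def drop : StackProg Stk (Letter Symb S.Rel) :=
  moveAll .aux .guess ;; (any fun a => pop .tmp a ;; move1 a a .guess .aux).star ;; empty .guess

theorem run_drop {u t : List (Letter Symb S.Rel)} :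
    (drop Symb S).Run n (layout i o f r t [] u.reverse) s' ↔
      u.length ≤ n ∧ ∃ t', t = u ++ t' ∧ s' = layout i o f r t' [] u.reverse := by
  have hstar (t g a : List (Letter Symb S.Rel)) :
      (any fun a => pop .tmp a ;; move1 a a .guess .aux).star.Run n (layout i o f r t g a) s' ↔
        ∃ v t' g', v.length ≤ n ∧ t = v ++ t' ∧ g = v ++ g' ∧
          s' = layout i o f r t' g' (v.reverse ++ a) := by
    have := run_star_of_layout (n := n) (P := fun _ => True)
      (p := any fun a => pop .tmp a ;; move1 a a .guess .aux)
      (lay := fun x => layout i o f r x.1 x.2.1 x.2.2)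
      (R := fun u x x' => x.1 = u ++ x'.1 ∧ x.2.1 = u ++ x'.2.1 ∧ x'.2.2 = u.reverse ++ x.2.2)
      ?_ (by grind) ?_ (t, g, a) s'
    · simpa [and_assoc] using this
    · simp only [run_any, run_seq, run_pop, layout, update_layout_tmp, run_move1, Transfer,
        List.cons_append, List.nil_append, Emit, List.reverse_cons, List.reverse_nil, ne_eq,
        reduceCtorEq, not_false_eq_true, Function.update_of_ne, ↓existsAndEq, and_true,
        update_layout_guess, update_layout_aux, true_and, Prod.exists, Prod.forall]
      grind
    · simp only [List.cons_append, List.reverse_cons, List.append_assoc, List.nil_append,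
        Prod.exists, ↓existsAndEq, and_true, true_and, Prod.forall]
      grind
  simp only [drop, run_seq, run_moveAll (K := Stk) (k := .aux) (l := .guess) (by decide), layout,
    update_layout_aux, update_layout_guess, List.reverse_reverse, List.append_nil, run_empty,
    List.length_reverse]
  constructor
  · rintro ⟨_, ⟨hu, rfl⟩, _, h, hg, rfl⟩
    obtain ⟨v, t', g', -, rfl, rfl, rfl⟩ := (hstar ..).1 h
    obtain rfl : g' = [] := hg
    simp only [List.append_nil] at hu ⊢
    exact ⟨hu, t', rfl, rfl⟩
  · rintro ⟨hu, t', rfl, rfl⟩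
    exact ⟨_, ⟨hu, rfl⟩, _, (hstar ..).2 ⟨u, t', [], hu, by simp⟩, rfl, rfl⟩

variable (Symb S) in
/-- The program that empties `aux`. -/
noncomputable def clearAux : StackProg Stk (Letter Symb S.Rel) :=
  (any fun a => pop .aux a).star ;; empty .aux

theorem run_clearAux {t : List (Letter Symb S.Rel)} :
    (clearAux Symb S).Run n (layout i o f r t g a) s' ↔
      a.length ≤ n ∧ s' = layout i o f r t g [] := by
  have hstar (a : List (Letter Symb S.Rel)) := run_star_of_layout (n := n) (P := fun _ => True)
    (p := any fun a => pop .aux a) (lay := fun a => layout i o f r t g a)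
    (R := fun u a a' => a = u ++ a') (by simp) (by grind) (by simp) a
  simp only [clearAux, run_seq, hstar, run_empty]
  constructor
  · rintro ⟨_, ⟨u, x, hu, -, rfl, rfl⟩, rfl : x = [], rfl⟩
    simpa using hu
  · rintro ⟨ha, rfl⟩
    exact ⟨_, ⟨a, [], ha, by simp⟩, rfl, rfl⟩

variable (Symb S) in
/-- The program that deletes all occurrences of a fact. -/
noncomputable def deleteFact : StackProg Stk (Letter Symb S.Rel) :=
  factProg (push .aux) ;; moveAll .facts .tmp ;;
  ((moveFact .tmp .facts).alt (drop Symb S)).star ;; empty .tmp ;; clearAux Symb S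

theorem run_star_moveFact_alt_drop {d : Fact S} {t : List (Letter Symb S.Rel)} :
    ((moveFact .tmp .facts).alt (drop Symb S)).star.Run n
        (layout i o f r t [] (encFact d).reverse) s' ↔
      ∃ u : List (Bool × Fact S), u.length ≤ n ∧
        (∀ c ∈ u, if c.1 then c.2.IsShort n
          else (encFact d : List (Letter Symb S.Rel)).length ≤ n ∧ c.2 = d) ∧
        ∃ t', t = encFacts (u.map Prod.snd) ++ t' ∧
          s' = layout i o ((encFacts ((u.filter Prod.fst).map Prod.snd)).reverse ++ f) r t' []
            (encFact d).reverse := by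
  have := run_star_of_layout (n := n) (p := (moveFact .tmp .facts).alt (drop Symb S))
    (P := fun c : Bool × Fact S => if c.1 then c.2.IsShort n
      else (encFact d : List (Letter Symb S.Rel)).length ≤ n ∧ c.2 = d)
    (lay := fun x => layout i o x.2 r x.1 [] (encFact d).reverse)
    (R := fun u x x' => x.1 = encFacts (u.map Prod.snd) ++ x'.1 ∧
      x'.2 = (encFacts ((u.filter Prod.fst).map Prod.snd)).reverse ++ x.2)
    ?_ (by grind [encFacts_nil]) ?_ (t, f) s'
  · simpa using this
  · rintro ⟨t, f⟩ s'
    simp only [run_alt, run_moveFact (k := Stk.tmp) (l := .facts) (by decide), run_drop,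
      Transfer, Emit, Prod.exists, Bool.exists_bool]
    simp only [layout, update_layout_tmp, ne_eq, reduceCtorEq, not_false_eq_true,
      Function.update_of_ne, update_layout_facts, Sigma.exists, ↓existsAndEq, Bool.false_eq_true,
      ↓reduceIte, List.map_cons, List.map_nil, encFacts_cons, encFacts_nil, List.append_nil,
      List.filter_cons_of_neg, List.filter_nil, List.reverse_nil, List.nil_append, and_true,
      exists_and_left, List.filter_cons_of_pos]
    grind
  · rintro ⟨_ | _, f⟩ u ⟨t, g⟩ ⟨t', g'⟩ <;> simp [encFacts_cons, encFacts_nil]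

/-- `F'` contains the same facts as `F`, with the possible exception of a single fact. -/
def IsEdit (F F' : List (Fact S)) : Prop := ∃ d, ∀ f ≠ d, f ∈ F' ↔ f ∈ F

theorem isEdit_of_run_deleteFact {F : List (Fact S)}
    (h : (deleteFact Symb S).Run n (layout i o (encFacts F).reverse r [] [] []) s') :
    ∃ F', IsEdit F F' ∧ s' = layout i o (encFacts F').reverse r [] [] [] := by
  obtain ⟨_, h, _, hmove, h'⟩ := h
  obtain ⟨d, -, rfl⟩ := (run_factProg isAction_emit fun _ _ _ => run_push).1 h
  obtain ⟨-, rfl⟩ := (run_moveAll (by decide)).1 hmove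
  simp only [layout, update_layout_aux, update_layout_facts, update_layout_tmp,
    List.reverse_reverse, List.append_nil] at h'
  obtain ⟨_, hstar, _, ⟨ht, rfl⟩, h'⟩ := h'
  obtain ⟨u, -, hu, t, hF, rfl⟩ := run_star_moveFact_alt_drop.1 hstar
  obtain rfl : t = [] := ht
  obtain ⟨-, rfl⟩ := run_clearAux.1 h'
  rw [List.append_nil] at hF
  obtain rfl := encFacts_injective hF
  refine ⟨_, ⟨d, fun f hf => ?_⟩, by rw [List.append_nil]⟩
  simp only [List.mem_map, List.mem_filter, Prod.exists, exists_eq_right, Bool.exists_bool]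
  grind

theorem run_deleteFact {F : List (Fact S)} {d : Fact S}
    (hF : (encFacts F : List (Letter Symb S.Rel)).length ≤ n)
    (hd : (encFact d : List (Letter Symb S.Rel)).length ≤ n) :
    (deleteFact Symb S).Run n (layout i o (encFacts F).reverse r [] [] [])
      (layout i o (encFacts (F.filter (· ≠ d))).reverse r [] [] []) := by
  have hstar : ((moveFact .tmp .facts).alt (drop Symb S)).star.Run n
        (layout i o [] r (encFacts F) [] (encFact d).reverse)
        (layout i o (encFacts (F.filter (· ≠ d))).reverse r [] [] (encFact d).reverse) := by
    refine run_star_moveFact_alt_drop.2 ⟨F.map fun f => (f ≠ d, f), ?_, ?_, [], ?_, ?_⟩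
    · simpa using (length_le_length_encFacts F).trans hF
    · intro c hc
      obtain ⟨f, hf, rfl⟩ := List.mem_map.1 hc
      have := Fact.isShort_of_length_encFact_le ((length_encFact_le_length_encFacts hf).trans hF)
      grind
    · simp [Function.comp_def]
    · simp [List.filter_map, Function.comp_def]
  refine ⟨_, (run_factProg isAction_emit fun _ _ _ => run_push).2
    ⟨d, Fact.isShort_of_length_encFact_le hd, rfl⟩, _,
    (run_moveAll (by decide)).2 ⟨by simpa using hF, rfl⟩, _, by simpa using hstar, _,
    ⟨rfl, rfl⟩, ?_⟩
  simpa [run_clearAux] using hd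

end Programs

open scoped symmDiff

section Programs

variable {Symb : Type} {S : Schema} [Finite Symb] {n : ℕ} {i o f r : List (Letter Symb S.Rel)}
  {s' : Stk → List (Letter Symb S.Rel)}

theorem IsEdit.card_symmDiff_le {F F' : List (Fact S)} (h : IsEdit F F') (I : Instance S) :
    (I ∆ F'.toFinset).card ≤ (I ∆ F.toFinset).card + 1 := by
  obtain ⟨d, hd⟩ := h
  have : I ∆ F'.toFinset ⊆ insert d (I ∆ F.toFinset) := by
    intro f
    simp only [Finset.mem_symmDiff, Finset.mem_insert, List.mem_toFinset]
    grind
  exact (Finset.card_le_card this).trans (Finset.card_insert_le _ _)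

variable (Symb S) in
/-- The program that inserts or deletes a fact and subtracts one from the counter on `inp`. -/
noncomputable def edit : StackProg Stk (Letter Symb S.Rel) :=
  decr Symb S ;; (insertFact Symb S).alt (deleteFact Symb S)

theorem isEdit_of_run_edit {b : List Bool} {F : List (Fact S)}
    (h : (edit Symb S).Run n (layout (encBits b) o (encFacts F).reverse r [] [] []) s') :
    ∃ b' F', IsDecr b b' ∧ IsEdit F F' ∧
      s' = layout (encBits b') o (encFacts F').reverse r [] [] [] := by
  obtain ⟨_, hdecr, hedit⟩ := h
  obtain ⟨b', hb, rfl⟩ := (run_decr (le_max_right n b.length)).1 (hdecr.mono (le_max_left ..))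
  refine ⟨b', ?_⟩
  rcases hedit with h | h
  · obtain ⟨d, -, rfl⟩ := run_insertFact.1 h
    exact ⟨_, hb, ⟨d, by simp +contextual⟩, rfl⟩
  · obtain ⟨F', hF, rfl⟩ := isEdit_of_run_deleteFact h
    exact ⟨F', hb, hF, rfl⟩

theorem card_symmDiff_le_of_run_star_edit {b : List Bool} {F : List (Fact S)}
    (h : (edit Symb S).star.Run n (layout (encBits b) o (encFacts F).reverse r [] [] []) s') :
    ∃ b' F', (F.toFinset ∆ F'.toFinset).card ≤ bitsVal b ∧
      s' = layout (encBits b') o (encFacts F').reverse r [] [] [] := by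
  suffices ∃ b' F', (F.toFinset ∆ F'.toFinset).card + bitsVal b' ≤ bitsVal b ∧
      s' = layout (encBits b') o (encFacts F').reverse r [] [] [] by
    obtain ⟨b', F', hF, hs⟩ := this
    exact ⟨b', F', (Nat.le_add_right ..).trans hF, hs⟩
  refine h.star_invariant (I := fun s' => ∃ b' F',
    (F.toFinset ∆ F'.toFinset).card + bitsVal b' ≤ bitsVal b ∧
      s' = layout (encBits b') o (encFacts F').reverse r [] [] []) ?_ ⟨b, F, by simp, rfl⟩
  rintro _ _ ⟨b₁, F₁, hle, rfl⟩ h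
  obtain ⟨b₂, F₂, hb, hF, rfl⟩ := isEdit_of_run_edit h
  have := hb.bitsVal_eq
  have := hF.card_symmDiff_le F.toFinset
  exact ⟨b₂, F₂, by lia, rfl⟩

theorem exists_run_edit {b : List Bool} (hb : b.length ≤ n) (hb₀ : bitsVal b ≠ 0)
    {F : List (Fact S)} {J : Instance S} {d : Fact S} (hd : d ∈ F.toFinset ∆ J)
    (hn : (encFacts F : List (Letter Symb S.Rel)).length +
      (encFact d : List (Letter Symb S.Rel)).length ≤ n) :
    ∃ b' F', IsDecr b b' ∧ F'.toFinset ∆ J = (F.toFinset ∆ J).erase d ∧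
      (encFacts F' : List (Letter Symb S.Rel)).length ≤
        (encFacts F : List (Letter Symb S.Rel)).length +
          (encFact d : List (Letter Symb S.Rel)).length ∧
      (edit Symb S).Run n (layout (encBits b) o (encFacts F).reverse r [] [] [])
        (layout (encBits b') o (encFacts F').reverse r [] [] []) := by
  obtain ⟨b', hbb'⟩ := exists_isDecr hb₀
  have hrun {F' : List (Fact S)}
      (h : ((insertFact Symb S).alt (deleteFact Symb S)).Run n
        (layout (encBits b') o (encFacts F).reverse r [] [] [])
        (layout (encBits b') o (encFacts F').reverse r [] [] [])) :=
    (⟨_, (run_decr hb).2 ⟨b', hbb', rfl⟩, h⟩ : (edit Symb S).Run n _ _)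
  rcases Finset.mem_symmDiff.1 hd with ⟨hdF, hdJ⟩ | ⟨hdJ, hdF⟩
  · refine ⟨b', F.filter (· ≠ d), hbb', ?_, ?_,
      hrun (.inr (run_deleteFact (by lia) (by lia)))⟩
    · ext f
      simp only [Finset.mem_symmDiff, Finset.mem_erase, List.mem_toFinset, List.mem_filter] at *
      grind
    · have : (encFacts (F.filter (· ≠ d)) : List (Letter Symb S.Rel)).length ≤
          (encFacts F : List (Letter Symb S.Rel)).length :=
        (List.filter_sublist.flatMap _).length_le
      lia
  · refine ⟨b', F ++ [d], hbb', ?_, ?_, hrun (.inl (run_insertFact.2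
      ⟨d, Fact.isShort_of_length_encFact_le ((Nat.le_add_left ..).trans hn), rfl⟩))⟩
    · ext f
      simp only [Finset.mem_symmDiff, Finset.mem_erase, List.mem_toFinset, List.mem_append] at *
      grind
    · simp [encFacts_append, encFacts_cons, encFacts_nil]

theorem exists_run_star_edit {b : List Bool} (hb : b.length ≤ n) {F : List (Fact S)}
    {J : Instance S} {m M : ℕ} (hm : (F.toFinset ∆ J).card = m) (hmb : m ≤ bitsVal b) (hmn : m ≤ n)
    (hM : ∀ d ∈ F.toFinset ∆ J, (encFact d : List (Letter Symb S.Rel)).length ≤ M)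
    (hn : (encFacts F : List (Letter Symb S.Rel)).length + m * M ≤ n) :
    ∃ b' F', F'.toFinset = J ∧ (encFacts F' : List (Letter Symb S.Rel)).length ≤
        (encFacts F : List (Letter Symb S.Rel)).length + m * M ∧
      (edit Symb S).star.Run n (layout (encBits b) o (encFacts F).reverse r [] [] [])
        (layout (encBits b') o (encFacts F').reverse r [] [] []) := by
  suffices ∃ b' F', F'.toFinset = J ∧ (encFacts F' : List (Letter Symb S.Rel)).length ≤
        (encFacts F : List (Letter Symb S.Rel)).length + m * M ∧
      (Relation.Comp ((edit Symb S).Run n))^[m] Eq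
        (layout (encBits b) o (encFacts F).reverse r [] [] [])
        (layout (encBits b') o (encFacts F').reverse r [] [] []) by
    obtain ⟨b', F', hF, hlen, h⟩ := this
    exact ⟨b', F', hF, hlen, m, hmn, h⟩
  clear hmn
  induction m generalizing b F with
  | zero => exact ⟨b, F, by simpa using hm, by simp, rfl⟩
  | succ m ih =>
    obtain ⟨d, hd⟩ := Finset.card_pos.1 (by rw [hm]; exact m.succ_pos)
    have hdM := hM d hd
    rw [Nat.succ_mul] at hn ⊢
    obtain ⟨b₁, F₁, hbb₁, hF₁, hlen₁, hrun⟩ :=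
      exists_run_edit (o := o) (r := r) hb (by lia) hd (by lia)
    have hb₁ := hbb₁.bitsVal_eq
    obtain ⟨b', F', hF', hlen, h⟩ := ih (b := b₁) (F := F₁) (by rwa [hbb₁.length_eq])
      (by rw [hF₁, Finset.card_erase_of_mem hd]; lia) (by lia)
      (by rw [hF₁]; exact fun e he => hM e (Finset.mem_of_mem_erase he)) (by lia)
    refine ⟨b', F', hF', by lia, ?_⟩
    rw [Function.iterate_succ_apply']
    exact ⟨_, hrun, h⟩

variable (Symb S) in
/-- The program that puts the output together. -/
noncomputable def writeOutput : StackProg Stk (Letter Symb S.Rel) :=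
  moveAll .facts .tmp ;; moveAll .tmp .out ;; push .out .sep ;;
  moveAll .rest .tmp ;; moveAll .tmp .out

theorem run_writeOutput :
    (writeOutput Symb S).Run n (layout i o f r [] [] []) s' ↔
      f.length ≤ n ∧ r.length ≤ n ∧ s' = layout i (r ++ .sep :: (f ++ o)) [] [] [] [] [] := by
  simp [writeOutput, run_moveAll]

variable (Symb S) in
/-- The program that turns inputs of the bounded missing answer problem into inputs of the
evaluation problem, by guessing an update of the instance. -/
noncomputable def guessUpdate : StackProg Stk (Letter Symb S.Rel) :=
  readInput Symb S ;; (edit Symb S).star ;; writeOutput Symb S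

theorem card_symmDiff_le_of_run_guessUpdate {w : List (Letter Symb S.Rel)}
    (h : (guessUpdate Symb S).Run n (layout w [] [] [] [] [] []) s') :
    ∃ x F F' y k, .sep ∉ x ∧
      w = x ++ .sep :: (encFacts F ++ .sep :: (y ++ .sep :: encBits (Nat.bits k))) ∧
      (F.toFinset ∆ F'.toFinset).card ≤ k ∧
      (s' .out).reverse = x ++ .sep :: (encFacts F' ++ .sep :: y) := by
  obtain ⟨_, hread, _, hedit, hwrite⟩ := h
  obtain ⟨x, F, y, b, ⟨-, hx⟩, -, -, hb, -, rfl, rfl⟩ := run_readInput.1 hread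
  obtain ⟨b', F', hF, rfl⟩ := card_symmDiff_le_of_run_star_edit hedit
  obtain ⟨-, -, rfl⟩ := run_writeOutput.1 hwrite
  exact ⟨x, F, F', y, bitsVal b, hx, by rw [bits_bitsVal hb], hF, by simp⟩

theorem exists_run_guessUpdate {Q : List (Symb ⊕ Dom)} {F : List (Fact S)} {l : ℕ}
    {a : Fin l → Dom} {k : ℕ} {w : List (Letter Symb S.Rel)} (hw : w = encMAInput Q F a k)
    {J : Instance S} {M : ℕ} (hk : (F.toFinset ∆ J).card ≤ k)
    (hM : ∀ d ∈ F.toFinset ∆ J, (encFact d : List (Letter Symb S.Rel)).length ≤ M)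
    (hn : w.length + k * (M + 1) ≤ n) :
    ∃ F' s, F'.toFinset = J ∧ (guessUpdate Symb S).Run n (layout w [] [] [] [] [] []) s ∧
      (s .out).length ≤ n ∧ (s .out).reverse = encEvalInput Q F' a := by
  have hw' : w = encQuery Q ++ .sep ::
      (encFacts F ++ .sep :: (encTuple a ++ .sep :: encBits k.bits)) := by
    simp only [hw, encMAInput, encEvalInput, List.append_assoc, List.cons_append]
  have hlen := congrArg List.length hw'
  simp only [List.length_append, List.length_cons] at hlen
  have hbits : (encBits k.bits : List (Letter Symb S.Rel)).length = k.bits.length :=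
    List.length_map ..
  have hmM : (F.toFinset ∆ J).card * M ≤ k * M := Nat.mul_le_mul_right M hk
  rw [Nat.mul_succ] at hn
  obtain ⟨b', F', hJ, hF', hrun⟩ := exists_run_star_edit (n := n) (b := k.bits)
    (o := .sep :: (encQuery Q).reverse) (r := (encTuple a).reverse) (by lia) rfl
    (by rwa [bitsVal_bits]) (by lia) hM (by lia)
  refine ⟨F', _, hJ, ⟨_, run_readInput.2 ⟨encQuery Q, F, encTuple a, k.bits,
    ⟨by lia, sep_notMem_encQuery⟩, ⟨?_, fun f hf => ?_⟩, ⟨by lia, sep_notMem_encTuple⟩,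
    isCanonical_bits k, by lia, hw', rfl⟩, _, hrun, run_writeOutput.2 ⟨?_, ?_, rfl⟩⟩, ?_, ?_⟩
  · exact (length_le_length_encFacts (Symb := Symb) F).trans (by lia)
  · exact Fact.isShort_of_length_encFact_le
      ((length_encFact_le_length_encFacts (Symb := Symb) hf).trans (by lia))
  · rw [List.length_reverse]; lia
  · rw [List.length_reverse]; lia
  · simp only [layout, List.length_append, List.length_reverse, List.length_cons]
    lia
  · simp [encEvalInput]

end Programs

/-! ### Short repairs -/

section ShortRepairs

variable {S : Schema}

theorem Instance.rename_eq_self {ρ : Dom → Dom} {I : Instance S}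
    (h : ∀ f ∈ I, ∀ i, ρ (f.2 i) = f.2 i) : Instance.rename ρ I = I := by
  have hid : Set.EqOn (Fact.rename ρ) id (I : Set (Fact S)) := fun f hf =>
    congrArg (Sigma.mk f.1) (funext (h f hf))
  rw [Instance.rename, Finset.image_congr hid, Finset.image_id]

theorem Fact.rename_injective {ρ : Dom → Dom} (hρ : Function.Injective ρ) :
    Function.Injective (Fact.rename ρ : Fact S → Fact S) := by
  rintro ⟨r, a⟩ ⟨r', b⟩ h
  obtain ⟨rfl, h⟩ := Sigma.mk.inj_iff.1 h
  exact congrArg (Sigma.mk r) (hρ.comp_left (eq_of_heq h))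

theorem Instance.rename_symmDiff {ρ : Dom → Dom} (hρ : Function.Injective ρ) (I J : Instance S) :
    Instance.rename ρ (I ∆ J) = Instance.rename ρ I ∆ Instance.rename ρ J :=
  Finset.image_symmDiff I J (Fact.rename_injective hρ)

theorem exists_perm_length_le (N : Finset Dom) {n l : ℕ} (hnl : n < l) (hN : N.card ≤ 2 ^ l) :
    ∃ ρ : Equiv.Perm Dom, (∀ d, d.length ≤ n → ρ d = d) ∧ ∀ d ∈ N, (ρ d).length ≤ l := by
  obtain ⟨e⟩ : Nonempty (N ↪ List.Vector Bool l) :=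
    Function.Embedding.nonempty_of_card_le (by simpa using hN)
  let T : Set Dom := {d | d.length ≤ n ∨ d ∈ N}
  have hT : T.Finite := (List.finite_length_le Bool n).union N.finite_toSet
  let g : T ↪ Dom :=
    { toFun d := if h : d.1.length ≤ n then d else (e ⟨d, d.2.resolve_left h⟩).1
      inj' := by
        rintro ⟨c, hc⟩ ⟨d, hd⟩ h
        have hlen (x : N) : (e x).1.length = l := (e x).2
        have he (x y : N) (h : (e x).1 = (e y).1) : x = y := e.injective (Subtype.ext h)
        grind }
  have := hT.to_subtype
  obtain ⟨ρ, hρ⟩ := Cardinal.extend_function_of_lt g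
    (Cardinal.mk_lt_aleph0.trans_le (Cardinal.aleph0_le_mk Dom)) ⟨Equiv.refl Dom⟩
  refine ⟨ρ, fun d hd => (hρ ⟨d, .inl hd⟩).trans (dif_pos hd), fun d hd => ?_⟩
  rw [hρ ⟨d, .inr hd⟩]
  by_cases h : d.length ≤ n
  · exact (congrArg List.length (dif_pos h)).trans_le (h.trans hnl.le)
  · exact (congrArg List.length (dif_neg h)).trans_le (e ⟨d, hd⟩).2.le

theorem QueryClass.IsGeneric.mem_ans_rename {L : QueryClass S} (hgen : L.IsGeneric)
    {Q : List (L.Symb ⊕ Dom)} (hQ : Q ∈ L.queries) {I : Instance S} {a : Fin (L.arity Q) → Dom}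
    {ρ : Equiv.Perm Dom} (hρQ : ∀ d ∈ adom Q, ρ d = d) (hρa : ∀ i, ρ (a i) = a i)
    (ha : a ∈ L.ans Q I) : a ∈ L.ans Q (Instance.rename ρ I) :=
  hgen Q hQ I ρ hρQ ▸ ⟨a, ha, funext hρa⟩

/-- Renaming by a permutation that fixes `I` does not move `J` away from `I`. -/
theorem QueryClass.IsGeneric.exists_isShort_of_mem_ans {L : QueryClass S} (hgen : L.IsGeneric)
    {Q : List (L.Symb ⊕ Dom)} (hQ : Q ∈ L.queries) {I J : Instance S}
    {a : Fin (L.arity Q) → Dom} (ha : a ∈ L.ans Q J) {m n l : ℕ} (hm : ∀ r, S.arity r ≤ m)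
    (hnl : n < l) (hl : (I ∆ J).card * m ≤ 2 ^ l) (hQn : ∀ d ∈ adom Q, d.length ≤ n)
    (hIn : ∀ f ∈ I, f.IsShort n) (han : ∀ i, (a i).length ≤ n) :
    ∃ J', a ∈ L.ans Q J' ∧ (I ∆ J').card ≤ (I ∆ J).card ∧ ∀ f ∈ I ∆ J', f.IsShort l := by
  let N : Finset Dom := (I ∆ J).biUnion fun f => Finset.univ.image f.2
  have hN : N.card ≤ 2 ^ l :=
    (Finset.card_biUnion_le_card_mul _ _ _ fun f _ =>
      Finset.card_image_le.trans (by simpa using hm f.1)).trans hl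
  obtain ⟨ρ, hρ, hρN⟩ := exists_perm_length_le N hnl hN
  have hI : I ∆ Instance.rename ρ J = Instance.rename ρ (I ∆ J) := by
    rw [Instance.rename_symmDiff ρ.injective,
      Instance.rename_eq_self fun f hf i => hρ _ (hIn f hf i)]
  refine ⟨Instance.rename ρ J, hgen.mem_ans_rename hQ (fun d hd => hρ d (hQn d hd))
    (fun i => hρ _ (han i)) ha, hI ▸ Finset.card_image_le, ?_⟩
  rw [hI]
  intro f' hf'
  obtain ⟨f, hf, rfl⟩ := Finset.mem_image.1 hf'
  exact fun i =>
    hρN _ (Finset.mem_biUnion.2 ⟨f, hf, Finset.mem_image_of_mem _ (Finset.mem_univ i)⟩)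

theorem Update.symmDiff_apply {I : Instance S} (U : Update I) :
    I ∆ U.apply = U.ins ∪ U.del := by
  have hins := Finset.disjoint_left.1 U.ins_new
  have hdel := U.del_old
  ext f
  simp only [Update.apply, Finset.mem_symmDiff, Finset.mem_sdiff, Finset.mem_union]
  grind

theorem Update.exists_apply_eq (I J : Instance S) : ∃ U : Update I, U.apply = J := by
  refine ⟨⟨J \ I, I \ J, Finset.sdiff_disjoint, Finset.sdiff_subset⟩, ?_⟩
  ext f
  simp only [Update.apply, Finset.mem_sdiff, Finset.mem_union]
  tauto

theorem QueryClass.mem_maBound_iff {L : QueryClass S} {w : List (Letter L.Symb S.Rel)} :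
    w ∈ L.MABound ↔ ∃ Q ∈ L.queries, ∃ F, ∃ a : Fin (L.arity Q) → Dom, ∃ k,
      w = encMAInput Q F a k ∧ ∃ J, a ∈ L.ans Q J ∧ (F.toFinset ∆ J).card ≤ k := by
  constructor
  · rintro ⟨Q, hQ, F, a, k, hw, U, hU, hk⟩
    exact ⟨Q, hQ, F, a, k, hw, U.apply, hU, by rwa [U.symmDiff_apply]⟩
  · rintro ⟨Q, hQ, F, a, k, hw, J, ha, hk⟩
    obtain ⟨U, rfl⟩ := Update.exists_apply_eq F.toFinset J
    exact ⟨Q, hQ, F, a, k, hw, U, ha, by rwa [U.symmDiff_apply] at hk⟩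

end ShortRepairs

section GuessUpdate

variable {S : Schema} {L : QueryClass S} {n : ℕ}

instance QueryClass.finite_symb (L : QueryClass S) : Finite L.Symb :=
  have := L.finSymb
  inferInstance

theorem mem_maBound_of_run_guessUpdate {w : List (Letter L.Symb S.Rel)}
    {s : Stk → List (Letter L.Symb S.Rel)}
    (h : (guessUpdate L.Symb S).Run n (layout w [] [] [] [] [] []) s)
    (hs : (s .out).reverse ∈ L.Eval) : w ∈ L.MABound := by
  obtain ⟨x, F, F', y, k, hx, rfl, hk, hout⟩ := card_symmDiff_le_of_run_guessUpdate h
  obtain ⟨Q, hQ, G, a, hsG, ha⟩ := hs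
  obtain ⟨rfl, rfl, rfl⟩ := (encEvalInput_inj hx).1 (hout.symm.trans hsG)
  refine QueryClass.mem_maBound_iff.2 ⟨Q, hQ, F, a, k, ?_, F'.toFinset, ha, hk⟩
  simp only [encMAInput, encEvalInput, List.append_assoc, List.cons_append]

theorem length_le_length_encMAInput {Symb : Type} (Q : List (Symb ⊕ Dom)) (F : List (Fact S))
    {l : ℕ} (a : Fin l → Dom) (k : ℕ) :
    (encQuery Q : List (Letter Symb S.Rel)).length ≤
        (encMAInput Q F a k : List (Letter Symb S.Rel)).length ∧
      (encFacts F : List (Letter Symb S.Rel)).length ≤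
        (encMAInput Q F a k : List (Letter Symb S.Rel)).length ∧
      (encTuple a : List (Letter Symb S.Rel)).length ≤
        (encMAInput Q F a k : List (Letter Symb S.Rel)).length := by
  simp only [encMAInput, encEvalInput, List.length_append, List.length_cons]
  lia

theorem lt_two_pow_length_encMAInput {Symb : Type} (Q : List (Symb ⊕ Dom)) (F : List (Fact S))
    {l : ℕ} (a : Fin l → Dom) (k : ℕ) :
    k < 2 ^ (encMAInput Q F a k : List (Letter Symb S.Rel)).length := by
  have hbits : k < 2 ^ k.bits.length := by simpa only [bitsVal_bits] using bitsVal_lt k.bits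
  refine hbits.trans_le (Nat.pow_le_pow_right two_pos ?_)
  simp only [encMAInput, encBits, List.length_append, List.length_cons, List.length_map]
  lia

theorem add_mul_le_two_pow {n k : ℕ} (hk : k ≤ 2 ^ n) (c : ℕ) : n + k * c ≤ 2 ^ (n + c) :=
  calc n + k * c ≤ 2 ^ n + 2 ^ n * c := by gcongr; exact Nat.lt_two_pow_self.le
    _ = 2 ^ n * (c + 1) := by ring
    _ ≤ 2 ^ n * 2 ^ c := by gcongr; exact Nat.lt_two_pow_self
    _ = 2 ^ (n + c) := (pow_add ..).symm

theorem exists_run_guessUpdate_of_mem_maBound (hgen : L.IsGeneric) {m : ℕ}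
    (hm : ∀ r, S.arity r ≤ m) {w : List (Letter L.Symb S.Rel)} (hw : w ∈ L.MABound)
    (hn : 2 ^ (w.length + (m * (w.length + m + 2) + 2)) ≤ n) :
    ∃ s, (guessUpdate L.Symb S).Run n (layout w [] [] [] [] [] []) s ∧
      (s .out).length ≤ n ∧ (s .out).reverse ∈ L.Eval := by
  obtain ⟨Q, hQ, F, a, k, hwQ, J, ha, hk⟩ := QueryClass.mem_maBound_iff.1 hw
  have hkw : k ≤ 2 ^ w.length := hwQ ▸ (lt_two_pow_length_encMAInput Q F a k).le
  obtain ⟨hQw, hFw, haw⟩ := hwQ ▸ length_le_length_encMAInput Q F a k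
  have hconsts : (F.toFinset ∆ J).card * m ≤ 2 ^ (w.length + m + 1) :=
    calc (F.toFinset ∆ J).card * m ≤ 2 ^ w.length * 2 ^ m :=
          Nat.mul_le_mul (hk.trans hkw) Nat.lt_two_pow_self.le
      _ = 2 ^ (w.length + m) := (pow_add ..).symm
      _ ≤ 2 ^ (w.length + m + 1) := Nat.pow_le_pow_right two_pos (Nat.le_succ _)
  obtain ⟨J', ha', hJ', hshort⟩ := hgen.exists_isShort_of_mem_ans hQ ha hm (n := w.length)
    (by lia) hconsts (fun d hd => (length_le_length_encQuery hd).trans hQw)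
    (fun f hf => Fact.isShort_of_length_encFact_le
      ((length_encFact_le_length_encFacts (List.mem_toFinset.1 hf)).trans hFw))
    (fun i => (length_le_length_encTuple a i).trans haw)
  obtain ⟨F', s, rfl, hrun, hsn, hs⟩ := exists_run_guessUpdate hwQ (hJ'.trans hk)
    (fun d hd => (hshort d hd).length_encFact_le (hm _)) ((add_mul_le_two_pow hkw _).trans hn)
  exact ⟨s, hrun, hsn, Q, hQ, F', a, hs, ha'⟩

end GuessUpdate

end MissingAnswer

theorem mainTheorem10 (S : MissingAnswer.Schema) (L : MissingAnswer.QueryClass S)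
    (hgen : L.IsGeneric) (hEval : L.Eval ∈ NEXP) : L.MABound ∈ TwoNEXP := by
  let m := Finset.univ.sup S.arity
  have hm (r : S.Rel) : S.arity r ≤ m := Finset.le_sup (Finset.mem_univ r)
  let b : Polynomial ℕ := .X + (.C m * (.X + .C m + 2) + 2)
  refine mem_twoNEXP_of_stackProg hEval (MissingAnswer.guessUpdate L.Symb S) .inp .out b
    (fun w n s hrun hs => ?_) (fun w hw => ?_)
  · rw [MissingAnswer.update_nil_inp] at hrun
    exact MissingAnswer.mem_maBound_of_run_guessUpdate hrun hs
  · rw [MissingAnswer.update_nil_inp]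
    exact MissingAnswer.exists_run_guessUpdate_of_mem_maBound hgen hm hw (by simp [b])
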